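/- **The two representations.** Write $q=\frac{\sqrt2}{2}$. Let $R_1$ be the translation surface obtained from a regular octagon with unit sides and two horizontal sides, a unit square with horizontal and vertical sides, and a unit square with diagonal sides, as follows. The sides of the octagon are labelled $A,B,C,D,E,F,G,H$ counterclockwise, starting from the bottom side, and each of them is glued by a translation to the parallel side of a square that lies on the opposite side of that square: the bottom, right, top, left sides of the upright square are labelled $E,G,A,C$, and the lower right, upper right, upper left, lower left sides of the diagonal square are labelled $F,H,B,D$. Let $a=\sqrt{\frac{2\sqrt6}{3}}$ and $b=\frac{\sqrt2}{2}a$. Let $R_2$ be the translation surface obtained by gluing, by translations, the sides with equal labels of the following four polygons, whose sides are listed counterclockwise with their directions: two equilateral triangles of side $b$, namely $T_1$ with sides $A',G',H'$ in directions $0,\frac{2\pi}3,\frac{4\pi}3$ and $T_2$ with sides $D',E',I'$ in directions $\frac\pi3,\pi,\frac{5\pi}3$; and two semi-regular hexagons with all angles $\frac{2\pi}3$, namely $X_1$ with sides $G',B',H',F',A',C'$ of lengths $b,a,b,a,b,a$ and $X_2$ with sides $F',E',C',I',B',D'$ of lengths $a,b,a,b,a,b$, the sides of both having directions $-\frac\pi3,0,\frac\pi3,\frac{2\pi}3,\pi,\frac{4\pi}3$.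 **Trajectories.** A trajectory is a bi-infinite path on the surface that moves in a straight line with constant non-zero velocity inside the polygons, passes from a side to the corresponding point of the side glued to it, and never hits a vertex. Its cutting sequence is the bi-infinite word, determined up to a shift of the indices, of the labels of the sides that it hits, in order of time. **Derivation.** A word $w\in\{A,\dots,H\}^{\mathbb Z}$ is admissible in $\mathscr D_0$ if it is a bi-infinite path in the diagram with the arrows $$H\to B,\quad B\xrightarrow{G'}H,\quad B\to G,\quad F\xrightarrow{B'}B,\quad F\to D,\quad D\xrightarrow{I'}F,\quad D\to E,$$ $$A\to H,\quad G\to A,\quad G\xrightarrow{C'}C,\quad C\xrightarrow{F'}G,\quad C\to F,\quad E\to C .$$ Its derived sequence $w'$, a word in $A',\dots,I'$, is obtained from $w$ by inserting between consecutive letters the letter on the corresponding arrow (if there is one), replacing $A,D,E,H$ by $A',D',E',H'$, and dropping $B,C,F,G$. **The affine map.** Let $$\sigma=\begin{pmatrix}1&\frac{\sqrt3}3\\0&1\end{pmatrix}\begin{pmatrix}\frac{\sqrt2}{2}\sqrt{\frac{2\sqrt6}{3}}&0\\0&\frac{\sqrt3}{2}\sqrt{\frac{2\sqrt6}{3}}\end{pmatrix}\begin{pmatrix}1&1\\0&1\end{pmatrix}.$$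 Cut the octagon along its three diagonals in direction $\frac{7\pi}8$ that join, respectively, the common vertex of $G,H$ to that of $A,B$, the common vertex of $F,G$ to that of $B,C$, and the common vertex of $E,F$ to that of $C,D$; cut the upright square along its diagonal in direction $\frac{3\pi}4$ and the diagonal square along its horizontal diagonal. Glue the two halves of the diagonal square to the octagon along $B$ and $F$, the two halves of the upright square along $C$ and $G$, and leave the pieces separated along the three diagonals of the octagon. This gives two triangles and two hexagons (with sides glued in pairs), which $\sigma$ sends, up to translations, to $T_1,X_1,X_2,T_2$: the triangle with sides $A,H$ to $T_1$, the hexagon containing the trapezoid with sides $B,G$ to $X_1$, the one containing the trapezoid with sides $C,F$ to $X_2$, and the triangle with sides $D,E$ to $T_2$. **Theorem.** The cut and paste map followed by $\sigma$ induces a well-defined homeomorphism $\Psi_\sigma:R_1\to R_2$ (affine with linear part $\sigma$), and it is uniquely determined by this. Let $\tau$ be a trajectory in $R_1$ in a direction $\theta\in\Sigma_0=[\frac{7\pi}8,\pi]$. Then $\tau$ has a cutting sequence $c(\tau)$, and it is admissible in $\mathscr D_0$; its derived sequence $c(\tau)'$ is a bi-infinite word; $\tau'=\Psi_\sigma\tau$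 is a trajectory in $R_2$ with velocity $\sigma v$, where $v$ is the velocity of $\tau$; and the derived sequence of the cutting sequence of $\tau$ is the cutting sequence of $\tau'$ with respect to the sides of $R_2$: $$c(\tau')=c(\tau)'$$ (as bi-infinite words up to a shift of the indices). In particular, the derived sequence of $c(\tau)$ is again a cutting sequence. -/

import Mathlib

open Set

noncomputable section

namespace BouwMoller

/-- The Euclidean plane, in coordinates. -/
abbrev Plane := Fin 2 → ℝ

/-- The determinant of two plane vectors. -/
def cross (u v : Plane) : ℝ := u 0 * v 1 - u 1 * v 0

/-- The index after `i` in cyclic order. -/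
def next {n : ℕ} (i : Fin n) : Fin n := ⟨(i.1 + 1) % n, Nat.mod_lt _ i.pos⟩

/-- A polygonal representation of a translation surface: finitely many strictly convex polygons,
the vertices of each listed counterclockwise, with sides labelled by `L`. The `i`-th side of a
polygon goes from its `i`-th vertex to the next one. Every label is carried by exactly two sides,
which are parallel of the same length and lie on opposite sides of their polygons, so that they
can be glued by a translation. -/
structure PolygonalSurface (L : Type) where
  Face : Type
  finite_face : Finite Face
  size : Face → ℕ
  three_le_size : ∀ f, 3 ≤ size f
  vertex : (f : Face) → Fin (size f) → Plane
  label : (f : Face) → Fin (size f) → L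
  convex : ∀ f i j, j ≠ i → j ≠ next i →
    0 < cross (vertex f (next i) - vertex f i) (vertex f j - vertex f i)
  paired : ∀ l : L, ∃ s s' : (Σ f, Fin (size f)), s ≠ s' ∧
    ∀ r : (Σ f, Fin (size f)), label r.1 r.2 = l ↔ r = s ∨ r = s'
  opposite : ∀ s s' : (Σ f, Fin (size f)), s ≠ s' → label s.1 s.2 = label s'.1 s'.2 →
    vertex s.1 (next s.2) - vertex s.1 s.2 =
      vertex s'.1 s'.2 - vertex s'.1 (next s'.2)

namespace PolygonalSurface

variable {L : Type} (P : PolygonalSurface L)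

/-- The closed polygon `f`. -/
def region (f : P.Face) : Set Plane := convexHull ℝ (range (P.vertex f))

/-- The `i`-th closed side of the polygon `f`. -/
def edge (f : P.Face) (i : Fin (P.size f)) : Set Plane :=
  segment ℝ (P.vertex f i) (P.vertex f (next i))

/-- The disjoint union of the closed polygons. -/
abbrev Point := Σ f : P.Face, P.region f

/-- A point of a side is identified with the corresponding point of the other side carrying the
same label, under the translation that matches the two sides (reversing their orientations as
parts of the boundaries). -/
def Glued (x y : P.Point) : Prop :=
  ∃ (i : Fin (P.size x.1)) (j : Fin (P.size y.1)),
    (⟨x.1, i⟩ : Σ f, Fin (P.size f)) ≠ ⟨y.1, j⟩ ∧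
    P.label x.1 i = P.label y.1 j ∧
    x.2.1 ∈ P.edge x.1 i ∧
    y.2.1 = x.2.1 + (P.vertex y.1 (next j) - P.vertex x.1 i)

/-- The translation surface: the polygons glued along their sides, with the quotient topology. -/
abbrev Surface := Quot P.Glued

/-- The point of the surface represented by the point `x` of the polygon `f`. -/
def pt (f : P.Face) (x : Plane) (hx : x ∈ P.region f) : P.Surface := Quot.mk _ ⟨f, x, hx⟩

/-- The points of the surface that come from vertices of the polygons. -/
def vertices : Set P.Surface :=
  {z | ∃ f i, ∃ h : P.vertex f i ∈ P.region f, z = P.pt f (P.vertex f i) h}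

/-- The side labelled `l`, as a subset of the surface. -/
def side (l : L) : Set P.Surface :=
  {z | ∃ f i x, P.label f i = l ∧ x ∈ P.edge f i ∧ ∃ h : x ∈ P.region f, z = P.pt f x h}

/-- `τ` is a bi-infinite linear trajectory with constant velocity `v` never hitting a vertex: just
after and just before any time it moves in a straight line with velocity `v` in one of the
polygons. (When it reaches a side it therefore leaves from the corresponding point of the side
glued to it.) -/
structure IsTrajectory (v : Plane) (τ : ℝ → P.Surface) : Prop where
  avoids : ∀ t, τ t ∉ P.vertices
  forward : ∀ t, ∃ f x, ∃ ε > 0, ∀ s ∈ Ico (0 : ℝ) ε,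
    ∃ h : x + s • v ∈ P.region f, τ (t + s) = P.pt f (x + s • v) h
  backward : ∀ t, ∃ f x, ∃ ε > 0, ∀ s ∈ Ico (0 : ℝ) ε,
    ∃ h : x - s • v ∈ P.region f, τ (t - s) = P.pt f (x - s • v) h

/-- `w` is the cutting sequence of `τ`: the labels of the sides hit by `τ`, in the order of time.
As a bi-infinite word it is determined up to the choice of the letter with index `0`. -/
def IsCuttingSequence (τ : ℝ → P.Surface) (w : ℤ → L) : Prop :=
  ∃ t : ℤ → ℝ, StrictMono t ∧ range t = {r | ∃ l, τ r ∈ P.side l} ∧ ∀ n, τ (t n) ∈ P.side (w n)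

end PolygonalSurface

/-! ### The first representation: a regular octagon and two squares with unit sides -/

/-- The labels of the sides of the first representation. -/
inductive L1 | A | B | C | D | E | F | G | H
  deriving DecidableEq

/-- The polygons of the first representation: the octagon, the square with horizontal and vertical
sides and the square with diagonal sides. -/
inductive Face1 | oct | square | diamond
  deriving DecidableEq

/-- Half the square root of two. -/
def q : ℝ := √2 / 2

def size1 : Face1 → ℕ
  | .oct => 8
  | .square => 4
  | .diamond => 4

def vertex1 : (f : Face1) → Fin (size1 f) → Plane
  | .oct => ![![0, 0], ![1, 0], ![1 + q, q], ![1 + q, 1 + q], ![1, 1 + 2 * q], ![0, 1 + 2 * q],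
      ![-q, 1 + q], ![-q, q]]
  | .square => ![![1 + q, q], ![2 + q, q], ![2 + q, 1 + q], ![1 + q, 1 + q]]
  | .diamond => ![![1 + q, -q], ![1 + 2 * q, 0], ![1 + q, q], ![1, 0]]

/-- The sides of the octagon are labelled counterclockwise from `A`, the bottom one. Each of them
is glued to the parallel opposite side of a square (so `A` is the top of the upright square). -/
def label1 : (f : Face1) → Fin (size1 f) → L1
  | .oct => ![.A, .B, .C, .D, .E, .F, .G, .H]
  | .square => ![.E, .G, .A, .C]
  | .diamond => ![.F, .H, .B, .D]

/-! ### The second representation: two triangles and two semi-regular hexagons -/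

/-- The labels of the sides of the second representation (the primed letters). -/
inductive L2 | A | B | C | D | E | F | G | H | I
  deriving DecidableEq

/-- The polygons of the second representation: two triangles and two hexagons. -/
inductive Face2 | tri₁ | hex₁ | hex₂ | tri₂
  deriving DecidableEq

/-- The longer side length `√(2√6/3)` of the hexagons. -/
def a : ℝ := √(2 * √6 / 3)

/-- The shorter side length of the hexagons, which is also that of the triangles. -/
def b : ℝ := √2 / 2 * a

/-- The sine of `π / 3`. -/
def h : ℝ := √3 / 2

def size2 : Face2 → ℕ
  | .tri₁ => 3
  | .hex₁ => 6
  | .hex₂ => 6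
  | .tri₂ => 3

/-- The triangles are equilateral with sides `b`; the hexagons have all angles `2π/3` and sides
alternately `b`, `a`, starting with `b` for the first one and `a` for the second. -/
def vertex2 : (f : Face2) → Fin (size2 f) → Plane
  | .tri₁ => ![![0, 0], ![b, 0], ![b / 2, h * b]]
  | .hex₁ => ![![b / 2, h * b], ![b, 0], ![b + a, 0], ![3 * b / 2 + a, h * b],
      ![3 * b / 2 + a / 2, h * (a + b)], ![b / 2 + a / 2, h * (a + b)]]
  | .hex₂ => ![![3 * b / 2 + a / 2, h * (a + b)], ![3 * b / 2 + a, h * b],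
      ![5 * b / 2 + a, h * b], ![5 * b / 2 + 3 * a / 2, h * (a + b)],
      ![2 * b + 3 * a / 2, h * (a + 2 * b)], ![2 * b + a / 2, h * (a + 2 * b)]]
  | .tri₂ => ![![5 * b / 2 + 3 * a / 2, h * (a + b)], ![3 * b + 3 * a / 2, h * (a + 2 * b)],
      ![2 * b + 3 * a / 2, h * (a + 2 * b)]]

def label2 : (f : Face2) → Fin (size2 f) → L2
  | .tri₁ => ![.A, .G, .H]
  | .hex₁ => ![.G, .B, .H, .F, .A, .C]
  | .hex₂ => ![.F, .E, .C, .I, .B, .D]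
  | .tri₂ => ![.D, .E, .I]

/-! ### Well-formedness of the two representations -/

theorem q_pos : 0 < q := by unfold q; positivity
theorem q_sq : q * q = 1 / 2 := by
  have := Real.mul_self_sqrt (show (0 : ℝ) ≤ 2 by norm_num)
  unfold q; linarith
theorem a_pos : 0 < a := by unfold a; positivity
theorem b_pos : 0 < b := by unfold b; have := a_pos; positivity
theorem h_pos : 0 < h := by unfold h; positivity

instance : Fintype Face1 := ⟨{.oct, .square, .diamond}, fun x => by cases x <;> simp⟩

instance : Fintype Face2 := ⟨{.tri₁, .hex₁, .hex₂, .tri₂}, fun x => by cases x <;> simp⟩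

theorem convex1 : ∀ f i j, j ≠ i → j ≠ next i →
    0 < cross (vertex1 f (next i) - vertex1 f i) (vertex1 f j - vertex1 f i) := by
  have := q_pos
  have := q_sq
  intro f
  cases f <;> simp only [size1] <;> intro i j <;> fin_cases i <;> fin_cases j <;> intro h1 h2 <;>
  first
  | exact absurd rfl h1
  | exact absurd rfl h2
  | (simp [cross, vertex1, next] <;> nlinarith)

theorem paired1 : ∀ l : L1, ∃ s s' : (Σ f, Fin (size1 f)), s ≠ s' ∧
    ∀ r : (Σ f, Fin (size1 f)), label1 r.1 r.2 = l ↔ r = s ∨ r = s' := by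
  intro l
  cases l
  · exact ⟨⟨.oct, (0 : Fin 8)⟩, ⟨.square, (2 : Fin 4)⟩, by decide, by decide⟩
  · exact ⟨⟨.oct, (1 : Fin 8)⟩, ⟨.diamond, (2 : Fin 4)⟩, by decide, by decide⟩
  · exact ⟨⟨.oct, (2 : Fin 8)⟩, ⟨.square, (3 : Fin 4)⟩, by decide, by decide⟩
  · exact ⟨⟨.oct, (3 : Fin 8)⟩, ⟨.diamond, (3 : Fin 4)⟩, by decide, by decide⟩
  · exact ⟨⟨.oct, (4 : Fin 8)⟩, ⟨.square, (0 : Fin 4)⟩, by decide, by decide⟩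
  · exact ⟨⟨.oct, (5 : Fin 8)⟩, ⟨.diamond, (0 : Fin 4)⟩, by decide, by decide⟩
  · exact ⟨⟨.oct, (6 : Fin 8)⟩, ⟨.square, (1 : Fin 4)⟩, by decide, by decide⟩
  · exact ⟨⟨.oct, (7 : Fin 8)⟩, ⟨.diamond, (1 : Fin 4)⟩, by decide, by decide⟩

theorem opposite1 : ∀ s s' : (Σ f, Fin (size1 f)), s ≠ s' → label1 s.1 s.2 = label1 s'.1 s'.2 →
    vertex1 s.1 (next s.2) - vertex1 s.1 s.2 =
      vertex1 s'.1 s'.2 - vertex1 s'.1 (next s'.2) := by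
  rintro ⟨f, i⟩ ⟨g, j⟩
  revert i j
  cases f <;> cases g <;> simp only [size1] <;> intro i j <;> fin_cases i <;> fin_cases j <;>
  intro h1 h2 <;>
  first
  | exact absurd rfl h1
  | exact absurd h2 (by decide)
  | (ext k; fin_cases k <;> simp [vertex1, next] <;> ring)

theorem convex2 : ∀ f i j, j ≠ i → j ≠ next i →
    0 < cross (vertex2 f (next i) - vertex2 f i) (vertex2 f j - vertex2 f i) := by
  have := mul_pos h_pos a_pos
  have := mul_pos h_pos b_pos
  have := a_pos
  have := b_pos
  have := mul_pos (mul_pos h_pos a_pos) a_pos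
  have := mul_pos (mul_pos h_pos a_pos) b_pos
  have := mul_pos (mul_pos h_pos b_pos) b_pos
  intro f
  cases f <;> simp only [size2] <;> intro i j <;> fin_cases i <;> fin_cases j <;> intro h1 h2 <;>
  first
  | exact absurd rfl h1
  | exact absurd rfl h2
  | (simp [cross, vertex2, next] <;> nlinarith)

theorem paired2 : ∀ l : L2, ∃ s s' : (Σ f, Fin (size2 f)), s ≠ s' ∧
    ∀ r : (Σ f, Fin (size2 f)), label2 r.1 r.2 = l ↔ r = s ∨ r = s' := by
  intro l
  cases l
  · exact ⟨⟨.tri₁, (0 : Fin 3)⟩, ⟨.hex₁, (4 : Fin 6)⟩, by decide, by decide⟩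
  · exact ⟨⟨.hex₁, (1 : Fin 6)⟩, ⟨.hex₂, (4 : Fin 6)⟩, by decide, by decide⟩
  · exact ⟨⟨.hex₁, (5 : Fin 6)⟩, ⟨.hex₂, (2 : Fin 6)⟩, by decide, by decide⟩
  · exact ⟨⟨.hex₂, (5 : Fin 6)⟩, ⟨.tri₂, (0 : Fin 3)⟩, by decide, by decide⟩
  · exact ⟨⟨.hex₂, (1 : Fin 6)⟩, ⟨.tri₂, (1 : Fin 3)⟩, by decide, by decide⟩
  · exact ⟨⟨.hex₁, (3 : Fin 6)⟩, ⟨.hex₂, (0 : Fin 6)⟩, by decide, by decide⟩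
  · exact ⟨⟨.tri₁, (1 : Fin 3)⟩, ⟨.hex₁, (0 : Fin 6)⟩, by decide, by decide⟩
  · exact ⟨⟨.tri₁, (2 : Fin 3)⟩, ⟨.hex₁, (2 : Fin 6)⟩, by decide, by decide⟩
  · exact ⟨⟨.hex₂, (3 : Fin 6)⟩, ⟨.tri₂, (2 : Fin 3)⟩, by decide, by decide⟩

theorem opposite2 : ∀ s s' : (Σ f, Fin (size2 f)), s ≠ s' → label2 s.1 s.2 = label2 s'.1 s'.2 →
    vertex2 s.1 (next s.2) - vertex2 s.1 s.2 =
      vertex2 s'.1 s'.2 - vertex2 s'.1 (next s'.2) := by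
  rintro ⟨f, i⟩ ⟨g, j⟩
  revert i j
  cases f <;> cases g <;> simp only [size2] <;> intro i j <;> fin_cases i <;> fin_cases j <;>
  intro h1 h2 <;>
  first
  | exact absurd rfl h1
  | exact absurd h2 (by decide)
  | (ext k; fin_cases k <;> simp [vertex2, next] <;> ring)

/-- The representation of the surface by a regular octagon and two squares. -/
def R1 : PolygonalSurface L1 where
  Face := Face1
  finite_face := inferInstance
  size := size1
  three_le_size := fun f => by cases f <;> decide
  vertex := vertex1
  label := label1
  convex := convex1
  paired := paired1
  opposite := opposite1

/-- The representation of the surface by two equilateral triangles and two semi-regular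
hexagons. -/
def R2 : PolygonalSurface L2 where
  Face := Face2
  finite_face := inferInstance
  size := size2
  three_le_size := fun f => by cases f <;> decide
  vertex := vertex2
  label := label2
  convex := convex2
  paired := paired2
  opposite := opposite2

/-! ### The affine map from the first representation to the second -/

def σ₁ : Matrix (Fin 2) (Fin 2) ℝ := !![1, 1; 0, 1]

def σ₂ : Matrix (Fin 2) (Fin 2) ℝ :=
  !![√2 / 2 * √(2 * √6 / 3), 0; 0, √3 / 2 * √(2 * √6 / 3)]

def σ₃ : Matrix (Fin 2) (Fin 2) ℝ := !![1, √3 / 3; 0, 1]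

def σ : Matrix (Fin 2) (Fin 2) ℝ := σ₃ * σ₂ * σ₁

/-- The pieces into which the polygons of the first representation are cut: the octagon along its
three diagonals in direction `7π/8`, the upright square along its diagonal in direction `3π/4`, the
other square along its horizontal diagonal. -/
inductive Piece
  | octBottom | octLower | octUpper | octTop | squareLeft | squareRight | diamondTop | diamondBottom

namespace Piece

/-- The polygon of the first representation from which the piece is cut. -/
def source : Piece → Face1
  | octBottom | octLower | octUpper | octTop => .oct
  | squareLeft | squareRight => .square
  | diamondTop | diamondBottom => .diamond

/-- The vertices of the piece, among those of the polygon from which it is cut. -/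
def corners : (k : Piece) → Set (Fin (size1 k.source))
  | octBottom => ({7, 0, 1} : Set (Fin 8))
  | octLower => ({7, 1, 2, 6} : Set (Fin 8))
  | octUpper => ({6, 2, 3, 5} : Set (Fin 8))
  | octTop => ({3, 4, 5} : Set (Fin 8))
  | squareLeft => ({0, 1, 3} : Set (Fin 4))
  | squareRight => ({1, 2, 3} : Set (Fin 4))
  | diamondTop => ({1, 2, 3} : Set (Fin 4))
  | diamondBottom => ({0, 1, 3} : Set (Fin 4))

/-- The piece, as a closed polygon. -/
def region (k : Piece) : Set Plane := convexHull ℝ (vertex1 k.source '' k.corners)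

/-- The polygon of the second representation of which the piece becomes a part. -/
def target : Piece → Face2
  | octBottom => .tri₁
  | octLower | squareRight | diamondTop => .hex₁
  | octUpper | squareLeft | diamondBottom => .hex₂
  | octTop => .tri₂

/-- The translation that moves the piece to the place where it is pasted. The right half of the
upright square is pasted along `G`, the bottom half of the other one along `F`; the other two
halves are already in place, next to the sides `C` and `B` of the octagon. -/
def shift : Piece → Plane
  | squareRight => ![-2 - 2 * q, 0]
  | diamondBottom => ![-1 - 2 * q, 1 + 2 * q]
  | _ => 0

end Piece

/-- `Ψ` is the affine map `Ψ_σ` induced by `σ`: the composition of the cut and paste map and of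
the linear map `σ`. -/
def IsInducedMap (Ψ : R1.Surface ≃ₜ R2.Surface) : Prop :=
  ∀ (k : Piece) (x : Plane), x ∈ k.region →
    ∃ (h₁ : x ∈ R1.region k.source) (h₂ : σ.mulVec (x + k.shift) ∈ R2.region k.target),
      Ψ (R1.pt k.source x h₁) = R2.pt k.target (σ.mulVec (x + k.shift)) h₂

/-! ### Derivation of words -/

/-- The transition diagram of the directions in `[7π/8, π]`: `none` if there is no arrow from
the first letter to the second, and the list of the (at most one) letters on the arrow otherwise. -/
def arrow : L1 → L1 → Option (List L2)
  | .H, .B => some []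
  | .B, .H => some [.G]
  | .B, .G => some []
  | .F, .B => some [.B]
  | .F, .D => some []
  | .D, .F => some [.I]
  | .D, .E => some []
  | .A, .H => some []
  | .G, .A => some []
  | .G, .C => some [.C]
  | .C, .G => some [.F]
  | .C, .F => some []
  | .E, .C => some []
  | _, _ => none

/-- The letters `A, D, E, H` are kept (with a prime), the letters `B, C, F, G` are dropped. -/
def keep : L1 → List L2
  | .A => [.A]
  | .D => [.D]
  | .E => [.E]
  | .H => [.H]
  | _ => []

/-- The bi-infinite word `w` is a path in the transition diagram. -/
def Admissible (w : ℤ → L1) : Prop := ∀ n, (arrow (w n) (w (n + 1))).isSome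

/-- What replaces the letter `w n` in the derived sequence: the letter itself, if it is kept,
followed by the letter on the arrow from `w n` to `w (n + 1)`, if there is one. -/
def block (w : ℤ → L1) (n : ℤ) : List L2 :=
  keep (w n) ++ (arrow (w n) (w (n + 1))).getD []

/-- `u` is the derived sequence of the admissible word `w`, that is, the concatenation of the
blocks `block w n`, the `n`-th of them starting at index `p n`. As a bi-infinite word, it is
determined up to the choice of the letter with index `0`. -/
def IsDerived (w : ℤ → L1) (u : ℤ → L2) : Prop :=
  Admissible w ∧ ∃ p : ℤ → ℤ,
    (∀ n, p (n + 1) = p n + (block w n).length) ∧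
    (∀ m, ∃ n, p n ≤ m ∧ m < p (n + 1)) ∧
    ∀ n (i : Fin (block w n).length), u (p n + i) = (block w n).get i

/-- The unit vector in direction `θ`. -/
def direction (θ : ℝ) : Plane := ![Real.cos θ, Real.sin θ]

end BouwMoller

end

noncomputable section

namespace BouwMoller

/-! Cutting the octagon and the two squares along the prescribed diagonals gives eight pieces. Glued
along all their sides, they form a third polygonal surface, `pieces`, that refines both
representations: the sides of each are some of the sides of the pieces. `R1` is assembled from the
pieces in place, `R2` from the pieces after a translation and `σ`. Both are instances of
`Dissection`, for which the assembling map is shown once and for all to be a homeomorphism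
(`Dissection.homeo`) that respects vertices, sides and trajectories. The map `Ψ_σ` is the inverse of
one such homeomorphism followed by the other; it is unique because the pieces cover `R1`.

A trajectory therefore has a cutting sequence `w₀` with respect to the pieces, and its cutting
sequences in `R1` and `R2` are the two subwords of `w₀` made of the letters that are sides of the
respective representation (`Dissection.isCuttingSequence_homeo_comp`). What is left is local: for
directions in the sector, the signs of a few determinants tell through which sides a piece can be
entered and left (`trans0_of_crossing`). In the resulting list of transitions two cuts are never
adjacent, and a cut met between two letters of `R1` is precisely the letter on the corresponding
arrow of the diagram. Hence inserting the arrow letters recovers `w₀` from its `R1`-subword, and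
dropping `B`, `C`, `F`, `G` leaves its `R2`-subword (`isDerived_of_isSubword`).

Cutting sequences exist because a trajectory cannot run along a side without meeting a vertex, so
that its hits are isolated, and because it leaves every polygon within a bounded time, in the future
and in the past. -/

theorem cross_neg_left (u v : Plane) : cross (-u) v = -cross u v := by
  simp [cross]; ring

theorem cross_self (u : Plane) : cross u u = 0 := by
  simp [cross]; ring

theorem next_ne {n : ℕ} (hn : 3 ≤ n) (i : Fin n) : next i ≠ i := by
  intro h
  have h := congrArg Fin.val h
  have hi := i.2
  simp only [next] at h
  rcases Nat.lt_or_ge (i.1 + 1) n with h1 | h1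
  · rw [Nat.mod_eq_of_lt h1] at h; omega
  · rw [show i.1 + 1 = n by omega, Nat.mod_self] at h; omega

theorem next_next_ne {n : ℕ} (hn : 3 ≤ n) (i : Fin n) : next (next i) ≠ i := by
  intro h
  have h := congrArg Fin.val h
  have hi := i.2
  simp only [next] at h
  rcases Nat.lt_or_ge (i.1 + 1) n with h1 | h1
  · rw [Nat.mod_eq_of_lt h1] at h
    rcases Nat.lt_or_ge (i.1 + 1 + 1) n with h2 | h2
    · rw [Nat.mod_eq_of_lt h2] at h; omega
    · rw [show i.1 + 1 + 1 = n by omega, Nat.mod_self] at h; omega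
  · rw [show i.1 + 1 = n by omega, Nat.mod_self, Nat.mod_eq_of_lt (by omega)] at h; omega

/-! ### Heights over sides, and the gluing relation away from the vertices -/

namespace PolygonalSurface

variable {L : Type} (P : PolygonalSurface L)

/-- The `i`-th side of the polygon `f` as a vector. -/
def sideVec (f : P.Face) (i : Fin (P.size f)) : Plane := P.vertex f (next i) - P.vertex f i

/-- The signed distance, up to a positive factor, of `x` from the line through the `i`-th side of
`f`; it is nonnegative on the polygon. -/
def height (f : P.Face) (i : Fin (P.size f)) (x : Plane) : ℝ :=
  cross (P.sideVec f i) (x - P.vertex f i)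

variable {P}

theorem height_combo {f : P.Face} (i : Fin (P.size f)) (x y : Plane) {s t : ℝ} (hst : s + t = 1) :
    P.height f i (s • x + t • y) = s * P.height f i x + t * P.height f i y := by
  obtain rfl : t = 1 - s := by linarith
  simp [height, cross]; ring

theorem height_add_smul {f : P.Face} (i : Fin (P.size f)) (x v : Plane) (s : ℝ) :
    P.height f i (x + s • v) = P.height f i x + s * cross (P.sideVec f i) v := by
  simp [height, cross]; ring

theorem height_vertex {f : P.Face} (i : Fin (P.size f)) : P.height f i (P.vertex f i) = 0 := by
  simp [height, cross]

theorem height_vertex_next {f : P.Face} (i : Fin (P.size f)) :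
    P.height f i (P.vertex f (next i)) = 0 := cross_self _

theorem height_vertex_pos {f : P.Face} {i j : Fin (P.size f)} (h : j ≠ i) (h' : j ≠ next i) :
    0 < P.height f i (P.vertex f j) := P.convex f i j h h'

theorem vertex_mem_region (f : P.Face) (i : Fin (P.size f)) : P.vertex f i ∈ P.region f :=
  subset_convexHull _ _ (mem_range_self i)

theorem edge_subset_region (f : P.Face) (i : Fin (P.size f)) : P.edge f i ⊆ P.region f :=
  (convex_convexHull ℝ _).segment_subset (vertex_mem_region f i) (vertex_mem_region f _)

theorem height_of_mem_edge {f : P.Face} {i : Fin (P.size f)} {x : Plane} (hx : x ∈ P.edge f i) :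
    P.height f i x = 0 := by
  obtain ⟨s, t, -, -, hst, rfl⟩ := hx
  rw [height_combo i _ _ hst, height_vertex, height_vertex_next]; ring

/-- By strict convexity only the two ends of a side lie on its line, so every vertex satisfies the
alternative; the points that satisfy it form a convex set, which then contains the whole polygon.
Consequently the zero set of the height in the polygon is exactly the side. -/
theorem height_pos_or_mem_edge {f : P.Face} (i : Fin (P.size f)) {x : Plane}
    (hx : x ∈ P.region f) : 0 < P.height f i x ∨ x ∈ P.edge f i := by
  have key : P.region f ⊆ {x | 0 < P.height f i x ∨ x ∈ P.edge f i} := by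
    refine convexHull_min ?_ ?_
    · rintro _ ⟨j, rfl⟩
      by_cases h : j = i
      · subst h; exact Or.inr (left_mem_segment _ _ _)
      by_cases h' : j = next i
      · subst h'; exact Or.inr (right_mem_segment _ _ _)
      exact Or.inl (height_vertex_pos h h')
    · intro x hx y hy s t hs ht hst
      have nonneg : ∀ z, (0 < P.height f i z ∨ z ∈ P.edge f i) → 0 ≤ P.height f i z := by
        rintro z (hz | hz)
        · exact hz.le
        · exact (height_of_mem_edge hz).ge
      rcases hs.eq_or_lt with rfl | hs'
      · obtain rfl : t = 1 := by linarith
        simpa using hy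
      rcases ht.eq_or_lt with rfl | ht'
      · obtain rfl : s = 1 := by linarith
        simpa using hx
      have hx0 := nonneg x hx
      have hy0 := nonneg y hy
      rcases hx with hx | hx
      · left
        rw [height_combo i x y hst]; positivity
      rcases hy with hy | hy
      · left
        rw [height_combo i x y hst]; positivity
      exact Or.inr (convex_segment _ _ hx hy hs ht hst)
  exact key hx

theorem height_nonneg {f : P.Face} (i : Fin (P.size f)) {x : Plane} (hx : x ∈ P.region f) :
    0 ≤ P.height f i x := by
  rcases height_pos_or_mem_edge i hx with h | h
  · exact h.le
  · exact (height_of_mem_edge h).ge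

theorem mem_edge_of_height {f : P.Face} {i : Fin (P.size f)} {x : Plane} (hx : x ∈ P.region f)
    (h : P.height f i x = 0) : x ∈ P.edge f i :=
  (height_pos_or_mem_edge i hx).resolve_left h.not_gt

/-- A point strictly inside side `j` with height zero over side `i` forces both ends of `j` onto the
line of `i`. If `j ≠ i`, the first end gives `j = next i`, and then `next j` is off that line, since
there are at least three vertices. -/
theorem edge_eq_of_mem {f : P.Face} {i j : Fin (P.size f)} {x : Plane} (hi : x ∈ P.edge f i)
    (hj : x ∈ P.edge f j) (hx : ∀ k, x ≠ P.vertex f k) : i = j := by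
  by_contra hij
  have h0 := height_of_mem_edge hi
  obtain ⟨s, t, hs, ht, hst, rfl⟩ := hj
  rcases hs.eq_or_lt with rfl | hs'
  · obtain rfl : t = 1 := by linarith
    exact hx (next j) (by simp)
  rcases ht.eq_or_lt with rfl | ht'
  · obtain rfl : s = 1 := by linarith
    exact hx j (by simp)
  rw [height_combo i _ _ hst] at h0
  have h1 := height_nonneg i (vertex_mem_region f j)
  have h2 := height_nonneg i (vertex_mem_region f (next j))
  have h3 : j = next i := by
    by_contra h
    have := height_vertex_pos (Ne.symm hij) h
    nlinarith [mul_pos hs' this, mul_nonneg ht'.le h2]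
  have h4 : next j ≠ i := h3 ▸ next_next_ne (P.three_le_size f) i
  have h5 : next j ≠ next i := h3 ▸ next_ne (P.three_le_size f) (next i)
  have := height_vertex_pos h4 h5
  nlinarith [mul_pos ht' this, mul_nonneg hs'.le h1]

theorem glue_mem_edge {f g : P.Face} {i : Fin (P.size f)} {j : Fin (P.size g)}
    (hne : (⟨f, i⟩ : Σ f, Fin (P.size f)) ≠ ⟨g, j⟩) (hl : P.label f i = P.label g j) {x : Plane}
    (hx : x ∈ P.edge f i) : x + (P.vertex g (next j) - P.vertex f i) ∈ P.edge g j := by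
  have ho := P.opposite ⟨f, i⟩ ⟨g, j⟩ hne hl
  simp only at ho
  obtain ⟨s, t, hs, ht, hst, rfl⟩ := hx
  -- The coefficients are exchanged because the gluing reverses the orientation of the side.
  refine ⟨t, s, ht, hs, by linarith, ?_⟩
  obtain rfl : s = 1 - t := by linarith
  rw [show P.vertex f (next i) = P.vertex f i + (P.vertex g j - P.vertex g (next j)) by
    rw [← ho]; abel]
  module

theorem glued_mk {f g : P.Face} {i : Fin (P.size f)} {j : Fin (P.size g)}
    (hne : (⟨f, i⟩ : Σ f, Fin (P.size f)) ≠ ⟨g, j⟩) (hl : P.label f i = P.label g j) {x y : Plane}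
    (hx : x ∈ P.region f) (hy : y ∈ P.region g) (hxi : x ∈ P.edge f i)
    (h : y = x + (P.vertex g (next j) - P.vertex f i)) : P.Glued ⟨f, x, hx⟩ ⟨g, y, hy⟩ :=
  ⟨i, j, hne, hl, hxi, h⟩

theorem Glued.symm {x y : P.Point} (h : P.Glued x y) : P.Glued y x := by
  obtain ⟨i, j, hne, hl, hx, hy⟩ := h
  refine ⟨j, i, hne.symm, hl.symm, hy ▸ glue_mem_edge hne hl hx, ?_⟩
  have ho := P.opposite ⟨x.1, i⟩ ⟨y.1, j⟩ hne hl
  simp only at ho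
  rw [hy, sub_eq_iff_eq_add.1 ho]
  abel

theorem ne_vertex {f : P.Face} {x : Plane} {hx : x ∈ P.region f} (h : P.pt f x hx ∉ P.vertices)
    (k : Fin (P.size f)) : x ≠ P.vertex f k := by
  rintro rfl
  exact h ⟨f, k, hx, rfl⟩

/-- Away from the vertices a point lies on only one side of its polygon, and a label is carried by
only two sides, so a second gluing can only undo the first. -/
theorem Glued.trans {x y z : P.Point} (hxy : P.Glued x y) (hyz : P.Glued y z)
    (hv : (Quot.mk _ y : P.Surface) ∉ P.vertices) : x = z := by
  obtain ⟨f, x, hx⟩ := x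
  obtain ⟨g, y, hy⟩ := y
  obtain ⟨k, z, hz⟩ := z
  obtain ⟨i, j, hne, hl, hxi, hyx⟩ := hxy
  obtain ⟨j', m, hne', hl', hyj, hzy⟩ := hyz
  simp only at *
  have hyj' : y ∈ P.edge g j := hyx ▸ glue_mem_edge hne hl hxi
  obtain rfl := edge_eq_of_mem hyj' hyj (ne_vertex hv)
  have him : (⟨f, i⟩ : Σ f, Fin (P.size f)) = ⟨k, m⟩ := by
    obtain ⟨s, s', -, hs⟩ := P.paired (P.label f i)
    have h1 := (hs ⟨f, i⟩).1 rfl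
    have h2 := (hs ⟨g, j⟩).1 hl.symm
    have h3 := (hs ⟨k, m⟩).1 (hl'.symm.trans hl.symm)
    grind
  obtain rfl : f = k := congrArg Sigma.fst him
  obtain rfl : i = m := by simpa using him
  have ho := P.opposite ⟨f, i⟩ ⟨g, j⟩ hne hl
  simp only at ho
  have : x = z := by
    rw [hzy, hyx, sub_eq_iff_eq_add.1 ho]; abel
  subst this
  rfl

/-- A point of the surface that is not a vertex is represented by at most two points, which are
glued to each other. -/
theorem eq_or_glued_of_mk_eq {x y : P.Point} (h : (Quot.mk _ x : P.Surface) = Quot.mk _ y)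
    (hv : (Quot.mk _ x : P.Surface) ∉ P.vertices) : x = y ∨ P.Glued x y := by
  have h' := Quot.eqvGen_exact h
  clear h
  induction h' with
  | rel x y h => exact Or.inr h
  | refl x => exact Or.inl rfl
  | symm x y h ih =>
    have e : (Quot.mk _ x : P.Surface) = Quot.mk _ y := Quot.eqvGen_sound h
    rcases ih (e ▸ hv) with h | h
    · exact Or.inl h.symm
    · exact Or.inr h.symm
  | trans x y z h h' ih ih' =>
    have e : (Quot.mk _ x : P.Surface) = Quot.mk _ y := Quot.eqvGen_sound h
    rcases ih hv with rfl | h1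
    · exact ih' hv
    rcases ih' (e ▸ hv) with rfl | h2
    · exact Or.inr h1
    exact Or.inl (h1.trans h2 (e ▸ hv))

theorem pt_eq_cases {f g : P.Face} {x y : Plane} {hx : x ∈ P.region f} {hy : y ∈ P.region g}
    (h : P.pt f x hx = P.pt g y hy) (hv : P.pt f x hx ∉ P.vertices) :
    (f = g ∧ x = y) ∨ ∃ i j, (⟨f, i⟩ : Σ f, Fin (P.size f)) ≠ ⟨g, j⟩ ∧ P.label f i = P.label g j ∧
      x ∈ P.edge f i ∧ y = x + (P.vertex g (next j) - P.vertex f i) := by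
  rcases eq_or_glued_of_mk_eq h hv with h | h
  · left
    cases h
    exact ⟨rfl, rfl⟩
  · exact Or.inr h

/-- Points inside a polygon are not identified with any other point. -/
theorem eq_of_pt_eq {f g : P.Face} {x y : Plane} {hx : x ∈ P.region f} {hy : y ∈ P.region g}
    (h : P.pt f x hx = P.pt g y hy) (hv : P.pt f x hx ∉ P.vertices)
    (hs : ∀ i, x ∉ P.edge f i) : f = g ∧ x = y := by
  rcases pt_eq_cases h hv with h | ⟨i, -, -, -, hi, -⟩
  · exact h
  · exact absurd hi (hs i)

theorem pt_glue {f g : P.Face} {i : Fin (P.size f)} {j : Fin (P.size g)}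
    (hne : (⟨f, i⟩ : Σ f, Fin (P.size f)) ≠ ⟨g, j⟩) (hl : P.label f i = P.label g j) {x y : Plane}
    (hx : x ∈ P.region f) (hy : y ∈ P.region g) (hxi : x ∈ P.edge f i)
    (h : y = x + (P.vertex g (next j) - P.vertex f i)) : P.pt f x hx = P.pt g y hy :=
  Quot.sound (glued_mk hne hl hx hy hxi h)

theorem pt_mem_side {f : P.Face} {i : Fin (P.size f)} {x : Plane} (hx : x ∈ P.region f)
    (hi : x ∈ P.edge f i) : P.pt f x hx ∈ P.side (P.label f i) :=
  ⟨f, i, x, rfl, hi, hx, rfl⟩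

theorem exists_edge_of_mem_side {f : P.Face} {x : Plane} {hx : x ∈ P.region f} {l : L}
    (h : P.pt f x hx ∈ P.side l) (hv : P.pt f x hx ∉ P.vertices) :
    ∃ i, P.label f i = l ∧ x ∈ P.edge f i := by
  obtain ⟨g, j, y, rfl, hy, hy', e⟩ := h
  rw [e] at hv
  rcases pt_eq_cases e.symm hv with ⟨rfl, rfl⟩ | ⟨i, k, hne, hl, hi, rfl⟩
  · exact ⟨j, rfl, hy⟩
  · obtain rfl := edge_eq_of_mem hi hy (ne_vertex hv)
    exact ⟨k, hl.symm, glue_mem_edge hne hl hi⟩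

theorem label_eq_of_mem_side {z : P.Surface} {l l' : L} (h : z ∈ P.side l) (h' : z ∈ P.side l')
    (hv : z ∉ P.vertices) : l = l' := by
  obtain ⟨f, i, x, rfl, hx, hx', rfl⟩ := h
  obtain ⟨j, rfl, hj⟩ := exists_edge_of_mem_side h' hv
  rw [edge_eq_of_mem hx hj (ne_vertex hv)]

/-- A side of the surface is the image of either of the two sides of polygons glued to it. -/
theorem mem_side_label {f : P.Face} {i : Fin (P.size f)} {z : P.Surface} :
    z ∈ P.side (P.label f i) ↔
      ∃ x, ∃ hx : x ∈ P.edge f i, z = P.pt f x (edge_subset_region f i hx) := by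
  constructor
  · rintro ⟨g, j, y, hl, hy, hy', rfl⟩
    by_cases hne : (⟨g, j⟩ : Σ f, Fin (P.size f)) = ⟨f, i⟩
    · obtain rfl : g = f := congrArg Sigma.fst hne
      obtain rfl : j = i := by simpa using hne
      exact ⟨y, hy, rfl⟩
    · exact ⟨_, glue_mem_edge hne hl hy, pt_glue hne hl hy' _ hy rfl⟩
  · rintro ⟨x, hx, rfl⟩
    exact pt_mem_side _ hx

end PolygonalSurface

/-! ### Two tools on the real line -/

/-- Induction along a real interval. -/
theorem real_induction {p : ℝ → Prop} {b : ℝ} (hp : p 0)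
    (left : ∀ s ∈ Ioc 0 b, (∀ r ∈ Ico 0 s, p r) → p s)
    (right : ∀ s ∈ Ico 0 b, p s → ∃ δ > 0, ∀ r ∈ Ioo s (s + δ), p r) :
    ∀ s ∈ Icc 0 b, p s := by
  intro s hs
  have hb : 0 ≤ b := hs.1.trans hs.2
  set A : Set ℝ := {s | s ∈ Icc 0 b ∧ ∀ r ∈ Icc 0 s, p r} with hA
  have h0 : (0 : ℝ) ∈ A := ⟨⟨le_rfl, hb⟩, fun r hr => by rwa [le_antisymm hr.2 hr.1]⟩
  have hbdd : BddAbove A := ⟨b, fun s hs => hs.1.2⟩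
  set c := sSup A
  have hc0 : 0 ≤ c := le_csSup hbdd h0
  have hcb : c ≤ b := csSup_le ⟨0, h0⟩ fun s hs => hs.1.2
  have hlt : ∀ r ∈ Ico 0 c, p r := fun r hr => by
    obtain ⟨s, hs, hrs⟩ := exists_lt_of_lt_csSup ⟨0, h0⟩ hr.2
    exact hs.2 r ⟨hr.1, hrs.le⟩
  have hpc : p c := by
    rcases hc0.eq_or_lt with h | h
    · rwa [← h]
    · exact left c ⟨h, hcb⟩ hlt
  rcases hcb.eq_or_lt with h | h
  · rcases hs.2.eq_or_lt with h' | h'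
    · rwa [h', ← h]
    · exact hlt s ⟨hs.1, h ▸ h'⟩
  · obtain ⟨δ, hδ, hr⟩ := right c ⟨hc0, h⟩ hpc
    have : c + min (δ / 2) (b - c) ∈ A := by
      have h1 : min (δ / 2) (b - c) ≤ δ / 2 := min_le_left _ _
      have h2 : min (δ / 2) (b - c) ≤ b - c := min_le_right _ _
      have h3 : 0 < min (δ / 2) (b - c) := lt_min (by linarith) (by linarith)
      refine ⟨⟨by linarith, by linarith⟩, fun r hr' => ?_⟩
      rcases lt_trichotomy r c with h4 | rfl | h4
      · exact hlt r ⟨hr'.1, h4⟩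
      · exact hpc
      · exact hr r ⟨h4, by linarith [hr'.2]⟩
    have h3 : 0 < min (δ / 2) (b - c) := lt_min (by linarith) (by linarith)
    linarith [le_csSup hbdd this]

/-- A locally finite set of reals that is unbounded in both directions is enumerated in increasing
order by the integers. -/
theorem exists_strictMono_range_eq {S : Set ℝ} (hfin : ∀ a b, (S ∩ Icc a b).Finite)
    (hgt : ∀ a, ∃ r ∈ S, a < r) (hlt : ∀ a, ∃ r ∈ S, r < a) :
    ∃ t : ℤ → ℝ, StrictMono t ∧ range t = S := by
  classical
  obtain ⟨r₀, hr₀, -⟩ := hgt 0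
  have : Nonempty S := ⟨⟨r₀, hr₀⟩⟩
  have : NoMaxOrder S := ⟨fun a => by
    obtain ⟨r, hr, h⟩ := hgt a; exact ⟨⟨r, hr⟩, h⟩⟩
  have : NoMinOrder S := ⟨fun a => by
    obtain ⟨r, hr, h⟩ := hlt a; exact ⟨⟨r, hr⟩, h⟩⟩
  let : LocallyFiniteOrder S := LocallyFiniteOrder.ofFiniteIcc fun a b => by
    refine Finite.of_finite_image (f := Subtype.val) ((hfin a b).subset ?_)
      Subtype.val_injective.injOn
    rintro _ ⟨x, hx, rfl⟩
    exact ⟨x.2, hx.1, hx.2⟩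
  let : SuccOrder S := LinearLocallyFiniteOrder.succOrder S
  let : PredOrder S := LinearLocallyFiniteOrder.predOrder S
  let e : S ≃o ℤ := orderIsoIntOfLinearSuccPredArch
  refine ⟨fun n => (e.symm n : ℝ), fun m n h => e.symm.strictMono h, ?_⟩
  ext r
  constructor
  · rintro ⟨n, rfl⟩; exact (e.symm n).2
  · intro hr; exact ⟨e ⟨r, hr⟩, by simp⟩

/-! ### Trajectories: discreteness of the hits and existence of cutting sequences -/

namespace PolygonalSurface

variable {L : Type} {P : PolygonalSurface L}

/-- The times at which a path is on a side. -/
def hits (P : PolygonalSurface L) (τ : ℝ → P.Surface) : Set ℝ := {r | ∃ l, τ r ∈ P.side l}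

variable {v : Plane} {τ : ℝ → P.Surface}

/-- Time reversal reduces statements about the past to statements about the future. -/
theorem IsTrajectory.reverse (hτ : P.IsTrajectory v τ) :
    P.IsTrajectory (-v) (fun t => τ (-t)) where
  avoids t := hτ.avoids _
  forward t := by
    obtain ⟨f, x, ε, hε, h⟩ := hτ.backward (-t)
    refine ⟨f, x, ε, hε, fun s hs => ?_⟩
    rw [smul_neg, ← sub_eq_add_neg, neg_add, ← sub_eq_add_neg]
    exact h s hs
  backward t := by
    obtain ⟨f, x, ε, hε, h⟩ := hτ.forward (-t)
    refine ⟨f, x, ε, hε, fun s hs => ?_⟩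
    rw [smul_neg, sub_neg_eq_add, neg_sub, show s - t = -t + s by ring]
    exact h s hs

theorem exists_dist_bound (P : PolygonalSurface L) :
    ∃ C, ∀ f, ∀ x ∈ P.region f, ∀ y ∈ P.region f, dist x y ≤ C := by
  have : Finite P.Face := P.finite_face
  have hb : Bornology.IsBounded (⋃ f, P.region f) := by
    refine Bornology.isBounded_iUnion.2 fun f => ?_
    exact isBounded_convexHull.2 (finite_range _).isBounded
  obtain ⟨C, hC⟩ := Metric.isBounded_iff.1 hb
  exact ⟨C, fun f x hx y hy => hC (mem_iUnion_of_mem f hx) (mem_iUnion_of_mem f hy)⟩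

/-- The polygons are finitely many and bounded, so a single time suffices to leave any of them. -/
theorem exists_notMem_region (hv : v ≠ 0) :
    ∃ b > (0 : ℝ), ∀ f x, x ∈ P.region f → x + b • v ∉ P.region f := by
  obtain ⟨C, hC⟩ := P.exists_dist_bound
  have hv' : 0 < ‖v‖ := norm_pos_iff.2 hv
  refine ⟨(|C| + 1) / ‖v‖, by positivity, fun f x hx hx' => ?_⟩
  have := hC f _ hx' _ hx
  rw [dist_eq_norm, add_sub_cancel_left, norm_smul, Real.norm_of_nonneg (by positivity),
    div_mul_cancel₀ _ hv'.ne'] at this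
  linarith [le_abs_self C]

/-- Motion parallel to a side keeps its height zero, hence stays on the side as long as it stays in
the polygon. The polygon `g` in which the motion is observed may be either of the two that share the
side. -/
theorem exists_pt_eq_of_parallel {f g : P.Face} {i : Fin (P.size f)} {x y : Plane}
    (hpar : cross (P.sideVec f i) v = 0) (hx : x ∈ P.edge f i) {hx' : x ∈ P.region f}
    {hy : y ∈ P.region g} (h : P.pt f x hx' = P.pt g y hy) (hv : P.pt f x hx' ∉ P.vertices)
    {s : ℝ} (hs : y + s • v ∈ P.region g) :
    ∃ hxs : x + s • v ∈ P.edge f i,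
      P.pt f (x + s • v) (edge_subset_region f i hxs) = P.pt g (y + s • v) hs := by
  rcases pt_eq_cases h hv with ⟨rfl, rfl⟩ | ⟨i', j, hne, hl, hi', rfl⟩
  · refine ⟨mem_edge_of_height hs ?_, rfl⟩
    rw [height_add_smul, hpar, height_of_mem_edge hx]; ring
  · obtain rfl := edge_eq_of_mem hx hi' (ne_vertex hv)
    have ho := P.opposite ⟨f, i⟩ ⟨g, j⟩ hne hl
    simp only at ho
    have hj : cross (P.sideVec g j) v = 0 := by
      have : P.sideVec g j = -P.sideVec f i := by rw [sideVec, sideVec, ho]; abel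
      rw [this, cross_neg_left, hpar, neg_zero]
    have hs' : x + (P.vertex g (next j) - P.vertex f i) + s • v ∈ P.edge g j := by
      refine mem_edge_of_height hs ?_
      rw [height_add_smul, hj, height_of_mem_edge (glue_mem_edge hne hl hx)]; ring
    have key : x + s • v = x + (P.vertex g (next j) - P.vertex f i) + s • v +
        (P.vertex f (next i) - P.vertex g j) := by
      rw [sub_eq_iff_eq_add.1 ho]; abel
    have hxs : x + s • v ∈ P.edge f i := key ▸ glue_mem_edge hne.symm hl.symm hs'
    exact ⟨hxs, (pt_glue hne.symm hl.symm _ _ hs' key).symm⟩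

/-- A trajectory does not run along a side, since it would hit a vertex. -/
theorem IsTrajectory.not_parallel (hτ : P.IsTrajectory v τ) (hv : v ≠ 0) {t : ℝ} {f : P.Face}
    {i : Fin (P.size f)} {x : Plane} (hx : x ∈ P.edge f i)
    (h : τ t = P.pt f x (edge_subset_region f i hx)) : cross (P.sideVec f i) v ≠ 0 := by
  intro hpar
  obtain ⟨b, hb, hout⟩ := exists_notMem_region (P := P) hv
  -- A trajectory parallel to a side would stay on it up to the time `b`, by which every polygon has
  -- been left.
  have := real_induction (b := b)
    (p := fun s => ∃ hs : x + s • v ∈ P.edge f i,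
      τ (t + s) = P.pt f (x + s • v) (edge_subset_region f i hs)) (by simpa using ⟨hx, h⟩) ?_ ?_ b
    ⟨hb.le, le_rfl⟩
  · exact hout f x (edge_subset_region f i hx) (edge_subset_region f i this.1)
  · intro s hs ih
    obtain ⟨g, y, ε, hε, hy⟩ := hτ.backward (t + s)
    have hm := min_le_left ε s
    have hm' := min_le_right ε s
    have hm0 : 0 < min ε s := lt_min hε hs.1
    -- Going back by half the minimum stays both within the backward chart and within the times
    -- covered by the induction hypothesis.
    obtain ⟨h1, h2⟩ := hy (min ε s / 2) ⟨by linarith, by linarith⟩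
    obtain ⟨h3, h4⟩ := ih (s - min ε s / 2) ⟨by linarith, by linarith⟩
    obtain ⟨h5, h6⟩ := hy 0 ⟨le_rfl, hε⟩
    rw [add_sub_assoc, h4] at h2
    obtain ⟨h7, h8⟩ := exists_pt_eq_of_parallel hpar h3 h2 (h4 ▸ hτ.avoids _)
      (s := min ε s / 2) (by simpa using h5)
    have e : x + (s - min ε s / 2) • v + (min ε s / 2) • v = x + s • v := by module
    simp only [e, sub_add_cancel] at h7 h8
    refine ⟨h7, ?_⟩
    simp only [sub_zero, zero_smul] at h6
    rw [h6, h8]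
  · rintro s - ⟨h1, h2⟩
    obtain ⟨g, y, ε, hε, hy⟩ := hτ.forward (t + s)
    refine ⟨ε, hε, fun r hr => ?_⟩
    obtain ⟨h3, h4⟩ := hy (r - s) ⟨by linarith [hr.1], by linarith [hr.2]⟩
    obtain ⟨h5, h6⟩ := hy 0 ⟨le_rfl, hε⟩
    simp only [add_zero, zero_smul] at h5 h6
    obtain ⟨h7, h8⟩ := exists_pt_eq_of_parallel hpar h1 (h2.symm.trans h6) (h2 ▸ hτ.avoids _)
      (s := r - s) h3
    have e : x + s • v + (r - s) • v = x + r • v := by module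
    simp only [e] at h7 h8
    refine ⟨h7, ?_⟩
    rw [h8, ← h4]
    congr 1; ring

theorem notMem_edge_of_notMem_hits {t : ℝ} (ht : t ∉ P.hits τ) {f : P.Face} {x : Plane}
    {hx : x ∈ P.region f} (h : τ t = P.pt f x hx) (i : Fin (P.size f)) : x ∉ P.edge f i :=
  fun hi => ht ⟨_, h ▸ pt_mem_side hx hi⟩

/-- Along a straight stretch in a polygon each height is a nonnegative affine function of time. A
zero strictly inside the stretch would make it constant, so the velocity would be parallel to a side
that is being hit. -/
theorem IsTrajectory.exists_forward_free (hτ : P.IsTrajectory v τ) (hv : v ≠ 0) (t : ℝ) :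
    ∃ ε > 0, ∀ s ∈ Ioo 0 ε, t + s ∉ P.hits τ := by
  obtain ⟨f, x, ε, hε, h⟩ := hτ.forward t
  refine ⟨ε, hε, ?_⟩
  rintro s hs ⟨l, hl⟩
  obtain ⟨h1, h2⟩ := h s ⟨hs.1.le, hs.2⟩
  rw [h2] at hl
  obtain ⟨i, -, hi⟩ := exists_edge_of_mem_side hl (h2 ▸ hτ.avoids _)
  refine hτ.not_parallel hv hi h2 ?_
  have h0 := height_of_mem_edge hi
  have h3 := height_nonneg i (h 0 ⟨le_rfl, hε⟩).1
  have h4 := height_nonneg i (h ((s + ε) / 2) ⟨by linarith [hs.1], by linarith [hs.2]⟩).1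
  rw [height_add_smul] at h0 h3 h4
  apply le_antisymm
  · nlinarith [hs.1]
  · nlinarith [hs.2]

theorem mem_hits_reverse {t : ℝ} : t ∈ P.hits (fun t => τ (-t)) ↔ -t ∈ P.hits τ := Iff.rfl

theorem IsTrajectory.exists_isolated (hτ : P.IsTrajectory v τ) (hv : v ≠ 0) (t : ℝ) :
    ∃ ε > 0, ∀ r ∈ P.hits τ, |r - t| < ε → r = t := by
  obtain ⟨ε, hε, h⟩ := hτ.exists_forward_free hv t
  obtain ⟨δ, hδ, h'⟩ := hτ.reverse.exists_forward_free (neg_ne_zero.2 hv) (-t)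
  refine ⟨min ε δ, lt_min hε hδ, fun r hr hrt => ?_⟩
  have h1 := abs_lt.1 (hrt.trans_le (min_le_left _ _))
  have h2 := abs_lt.1 (hrt.trans_le (min_le_right _ _))
  rcases lt_trichotomy r t with h3 | h3 | h3
  · refine absurd hr ?_
    have := h' (t - r) ⟨by linarith, by linarith⟩
    rwa [mem_hits_reverse, show -(-t + (t - r)) = r by ring] at this
  · exact h3
  · refine absurd hr ?_
    have := h (r - t) ⟨by linarith, by linarith⟩
    rwa [show t + (r - t) = r by ring] at this

theorem IsTrajectory.finite_hits (hτ : P.IsTrajectory v τ) (hv : v ≠ 0) (a b : ℝ) :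
    (P.hits τ ∩ Icc a b).Finite := by
  by_contra hinf
  obtain ⟨t, -, ht⟩ := Set.Infinite.exists_accPt_of_subset_isCompact hinf
    (isCompact_Icc (a := a) (b := b)) inter_subset_right
  obtain ⟨ε, hε, h⟩ := hτ.exists_isolated hv t
  rw [accPt_iff_frequently] at ht
  obtain ⟨r, ⟨hr, hr'⟩, hb⟩ := (ht.and_eventually (Metric.ball_mem_nhds t hε)).exists
  exact hr (h r hr'.1 (by simpa [Real.dist_eq] using hb))

/-- As long as it does not hit a side, a trajectory moves in a straight line in one polygon. -/
theorem IsTrajectory.exists_straight (hτ : P.IsTrajectory v τ) {t₁ t₂ : ℝ}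
    (hfree : ∀ t ∈ Ioo t₁ t₂, t ∉ P.hits τ) :
    ∃ f x, ∀ s ∈ Icc 0 (t₂ - t₁),
      ∃ h : x + s • v ∈ P.region f, τ (t₁ + s) = P.pt f (x + s • v) h := by
  obtain ⟨f, x, ε, hε, h⟩ := hτ.forward t₁
  refine ⟨f, x, real_induction (h 0 ⟨le_rfl, hε⟩) ?_ ?_⟩
  · intro s hs ih
    obtain ⟨g, y, ε, hε, hy⟩ := hτ.backward (t₁ + s)
    have hm := min_le_left ε s
    have hm' := min_le_right ε s
    have hm0 : 0 < min ε s := lt_min hε hs.1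
    obtain ⟨h1, h2⟩ := hy (min ε s / 2) ⟨by linarith, by linarith⟩
    obtain ⟨h3, h4⟩ := ih (s - min ε s / 2) ⟨by linarith, by linarith⟩
    obtain ⟨h5, h6⟩ := hy 0 ⟨le_rfl, hε⟩
    rw [add_sub_assoc, h4] at h2
    obtain ⟨rfl, h7⟩ := eq_of_pt_eq h2 (h4 ▸ hτ.avoids _)
      (notMem_edge_of_notMem_hits (hfree _ ⟨by linarith, by linarith [hs.2]⟩) h4)
    have e : y - (0 : ℝ) • v = x + s • v := by
      rw [← sub_eq_zero] at h7 ⊢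
      rw [← neg_eq_zero, ← h7]; module
    simp only [e, sub_zero] at h5 h6
    exact ⟨h5, h6⟩
  · rintro s hs ⟨h1, h2⟩
    rcases hs.1.eq_or_lt with rfl | hs0
    -- At the initial time the path may be on a side, where its representative is not unique, so the
    -- chart already chosen there is used.
    · exact ⟨ε, hε, fun r hr => h r ⟨hr.1.le, by linarith [hr.2]⟩⟩
    obtain ⟨g, y, ε, hε, hy⟩ := hτ.forward (t₁ + s)
    obtain ⟨h5, h6⟩ := hy 0 ⟨le_rfl, hε⟩
    rw [add_zero, h2] at h6
    obtain ⟨rfl, h7⟩ := eq_of_pt_eq h6 (h2 ▸ hτ.avoids _)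
      (notMem_edge_of_notMem_hits (hfree _ ⟨by linarith, by linarith [hs.2]⟩) h2)
    refine ⟨ε, hε, fun r hr => ?_⟩
    have h3 := hy (r - s) ⟨by linarith [hr.1], by linarith [hr.2]⟩
    have e : y + (r - s) • v = x + r • v := by
      rw [← sub_eq_zero] at h7 ⊢
      rw [← neg_eq_zero, ← h7]; module
    rw [show t₁ + s + (r - s) = t₁ + r by ring] at h3
    simpa only [e] using h3

/-- Without a further hit the path would stay in one polygon longer than any polygon allows. -/
theorem IsTrajectory.exists_hit_gt (hτ : P.IsTrajectory v τ) (hv : v ≠ 0) (t : ℝ) :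
    ∃ r ∈ P.hits τ, t < r := by
  by_contra! hcon
  obtain ⟨b, hb, hout⟩ := exists_notMem_region (P := P) hv
  obtain ⟨f, x, h⟩ := hτ.exists_straight (t₁ := t) (t₂ := t + b)
    fun r hr hr' => (hcon r hr').not_gt hr.1
  have h0 := (h 0 ⟨le_rfl, by linarith⟩).1
  rw [zero_smul, add_zero] at h0
  exact hout f x h0 (h b ⟨hb.le, by linarith⟩).1

theorem IsTrajectory.exists_hit_lt (hτ : P.IsTrajectory v τ) (hv : v ≠ 0) (t : ℝ) :
    ∃ r ∈ P.hits τ, r < t := by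
  obtain ⟨r, hr, h⟩ := hτ.reverse.exists_hit_gt (neg_ne_zero.2 hv) (-t)
  exact ⟨-r, hr, by linarith⟩

theorem IsTrajectory.exists_isCuttingSequence (hτ : P.IsTrajectory v τ) (hv : v ≠ 0) :
    ∃ w, P.IsCuttingSequence τ w := by
  obtain ⟨t, ht, hr⟩ := exists_strictMono_range_eq (hτ.finite_hits hv) (hτ.exists_hit_gt hv)
    (hτ.exists_hit_lt hv)
  have h : ∀ n, t n ∈ P.hits τ := fun n => hr ▸ mem_range_self n
  choose w hw using h
  exact ⟨w, t, ht, hr, hw⟩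

/-- Between two consecutive hits, a trajectory crosses a polygon from a side that it enters
through to a side that it leaves through. -/
theorem IsTrajectory.exists_crossing (hτ : P.IsTrajectory v τ) {t : ℤ → ℝ} {w : ℤ → L}
    (ht : StrictMono t) (hr : range t = P.hits τ) (hw : ∀ n, τ (t n) ∈ P.side (w n)) (n : ℤ) :
    ∃ f i j, ∃ x ∈ P.edge f i, ∃ d > (0 : ℝ), x + d • v ∈ P.edge f j ∧
      P.label f i = w n ∧ P.label f j = w (n + 1) ∧
      0 < cross (P.sideVec f i) v ∧ cross (P.sideVec f j) v < 0 ∧ ∀ k, x ≠ P.vertex f k := by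
  have hlt : t n < t (n + 1) := ht (lt_add_one n)
  have hfree : ∀ r ∈ Ioo (t n) (t (n + 1)), r ∉ P.hits τ := by
    rintro r hr' h
    rw [← hr] at h
    obtain ⟨m, rfl⟩ := h
    have h1 := ht.lt_iff_lt.1 hr'.1
    have h2 := ht.lt_iff_lt.1 hr'.2
    omega
  obtain ⟨f, x, h⟩ := hτ.exists_straight hfree
  set d := t (n + 1) - t n with hd
  have hd0 : 0 < d := sub_pos.2 hlt
  obtain ⟨h1, h2⟩ := h 0 ⟨le_rfl, hd0.le⟩
  simp only [zero_smul, add_zero] at h1 h2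
  obtain ⟨h3, h4⟩ := h d ⟨hd0.le, le_rfl⟩
  obtain ⟨h5, h6⟩ := h (d / 2) ⟨by linarith, by linarith⟩
  rw [show t n + d = t (n + 1) by rw [hd]; ring] at h4
  obtain ⟨i, hi, hi'⟩ := exists_edge_of_mem_side (h2 ▸ hw n) (h2 ▸ hτ.avoids _)
  obtain ⟨j, hj, hj'⟩ := exists_edge_of_mem_side (h4 ▸ hw (n + 1)) (h4 ▸ hτ.avoids _)
  -- The heights over both sides are positive at the midpoint, while one vanishes at the start and
  -- the other at the end; this fixes the signs of the two determinants.
  have hmid := notMem_edge_of_notMem_hits (hfree _ ⟨by linarith, by linarith⟩) h6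
  have h7 := (height_pos_or_mem_edge i h5).resolve_right (hmid i)
  have h8 := (height_pos_or_mem_edge j h5).resolve_right (hmid j)
  have h9 := height_of_mem_edge hi'
  have h10 := height_of_mem_edge hj'
  rw [height_add_smul] at h7 h8 h10
  refine ⟨f, i, j, x, hi', d, hd0, hj', hi, hj, ?_, ?_, ne_vertex (h2 ▸ hτ.avoids (t n))⟩
  · by_contra! hc
    nlinarith
  · by_contra! hc
    nlinarith

end PolygonalSurface

/-! ### Dissections, and the homeomorphisms that they induce -/

/-- If finitely many closed convex sets of reals cover the positive reals near `0`, one of them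
contains all nonnegative reals near `0`. -/
theorem exists_Ico_subset_of_cover {K : Type*} [Finite K] {C : K → Set ℝ}
    (hclosed : ∀ k, IsClosed (C k)) (hconn : ∀ k, (C k).OrdConnected) {ε : ℝ} (hε : 0 < ε)
    (hcover : ∀ s ∈ Ioo 0 ε, ∃ k, s ∈ C k) : ∃ k, ∃ δ > 0, δ ≤ ε ∧ Ico 0 δ ⊆ C k := by
  obtain ⟨k, hk⟩ : ∃ k, ∃ᶠ s in nhdsWithin (0 : ℝ) (Ioi 0), s ∈ C k := by
    by_contra! hcon
    have h1 : ∀ᶠ s in nhdsWithin (0 : ℝ) (Ioi 0), ∀ k, s ∉ C k :=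
      Filter.eventually_all.2 fun k => hcon k
    obtain ⟨s, hs, hs'⟩ := (h1.and (Ioo_mem_nhdsGT hε)).exists
    obtain ⟨k, hk⟩ := hcover s hs'
    exact hs k hk
  have hsmall : ∀ r > 0, ∃ s ∈ C k, s ∈ Ioo 0 r := fun r hr =>
    (hk.and_eventually (Ioo_mem_nhdsGT hr)).exists
  obtain ⟨δ, hδ, hδ'⟩ := hsmall ε hε
  refine ⟨k, δ, hδ'.1, hδ'.2.le, fun s hs => ?_⟩
  -- The chosen set has points arbitrarily close to `0`: closedness gives `0` itself, and
  -- order-connectedness fills in everything up to `δ`.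
  rcases hs.1.eq_or_lt with rfl | h0
  · exact (hclosed k).closure_eq ▸ (mem_closure_iff_frequently.2
      (hk.filter_mono nhdsWithin_le_nhds))
  · obtain ⟨r, hr, hr'⟩ := hsmall s h0
    exact (hconn k).out hr hδ ⟨hr'.2.le, hs.2.le⟩

/-- A dissection of the polygons of `P` into those of `Q`: after a translation by `shift` and the
application of the linear map `lin`, each polygon of `Q` becomes a part of a polygon of `P`, and
each side of a polygon of `P` is a side of a polygon of `Q`. -/
structure Dissection {L₀ L : Type} (Q : PolygonalSurface L₀) (P : PolygonalSurface L) where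
  lin : Plane ≃ₗ[ℝ] Plane
  face : Q.Face → P.Face
  shift : Q.Face → Plane
  incl : L → L₀
  edge : (Σ f, Fin (P.size f)) → Σ k, Fin (Q.size k)
  vertex_eq : ∀ k i, ∃ j, lin (Q.vertex k i + shift k) = P.vertex (face k) j
  cover : ∀ f, ∀ y ∈ P.region f, ∃ k, face k = f ∧ ∃ x ∈ Q.region k, lin (x + shift k) = y
  overlap : ∀ k l x y hx hy, k ≠ l → face k = face l → x + shift k = y + shift l →
    Q.Glued ⟨k, x, hx⟩ ⟨l, y, hy⟩
  edge_injective : Function.Injective edge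
  edge_face : ∀ s, face (edge s).1 = s.1
  edge_left : ∀ s, lin (Q.vertex (edge s).1 (edge s).2 + shift (edge s).1) = P.vertex s.1 s.2
  edge_right : ∀ s, lin (Q.vertex (edge s).1 (next (edge s).2) + shift (edge s).1) =
    P.vertex s.1 (next s.2)
  edge_label : ∀ s, Q.label (edge s).1 (edge s).2 = incl (P.label s.1 s.2)
  incl_injective : Function.Injective incl
  pasted_or_edge : ∀ s s' : (Σ k, Fin (Q.size k)), s ≠ s' →
    Q.label s.1 s.2 = Q.label s'.1 s'.2 →
    (face s.1 = face s'.1 ∧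
      Q.vertex s.1 s.2 + shift s.1 = Q.vertex s'.1 (next s'.2) + shift s'.1) ∨
    (s ∈ range edge ∧ s' ∈ range edge)

namespace PolygonalSurface

variable {L : Type} (P : PolygonalSurface L)

theorem isCompact_region (f : P.Face) : IsCompact (P.region f) :=
  (finite_range _).isCompact_convexHull ℝ

instance : CompactSpace P.Point := by
  have := P.finite_face
  have : ∀ f, CompactSpace (P.region f) := fun f => isCompact_iff_compactSpace.1
    (P.isCompact_region f)
  infer_instance

end PolygonalSurface

namespace Dissection

variable {L₀ L : Type} {Q : PolygonalSurface L₀} {P : PolygonalSurface L} (D : Dissection Q P)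

/-- The affine map that moves the polygon `k` of `Q` to its place in a polygon of `P`. -/
def place (k : Q.Face) (x : Plane) : Plane := D.lin (x + D.shift k)

theorem place_combo (k : Q.Face) (x y : Plane) {s t : ℝ} (hst : s + t = 1) :
    D.place k (s • x + t • y) = s • D.place k x + t • D.place k y := by
  obtain rfl : s = 1 - t := by linarith
  simp only [place, map_add, map_smul]
  module

theorem place_add (k : Q.Face) (x v : Plane) : D.place k (x + v) = D.place k x + D.lin v := by
  simp only [place, map_add]; abel

theorem continuous_place (k : Q.Face) : Continuous (D.place k) := by
  have : Continuous D.lin := D.lin.toLinearMap.continuous_of_finiteDimensional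
  unfold place; fun_prop

theorem place_mem_region {k : Q.Face} {x : Plane} (hx : x ∈ Q.region k) :
    D.place k x ∈ P.region (D.face k) := by
  have key : Q.region k ⊆ {x | D.place k x ∈ P.region (D.face k)} := by
    refine convexHull_min ?_ ?_
    · rintro _ ⟨i, rfl⟩
      obtain ⟨j, hj⟩ := D.vertex_eq k i
      rw [mem_ofPred_eq, place, hj]
      exact P.vertex_mem_region _ j
    · intro x hx y hy s t hs ht hst
      rw [mem_ofPred_eq, place_combo _ _ _ _ hst]
      exact convex_convexHull ℝ _ hx hy hs ht hst
  exact key hx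

/-- The map from the disjoint union of the polygons of `Q` to that of the polygons of `P`. -/
def placePoint (x : Q.Point) : P.Point :=
  ⟨D.face x.1, D.place x.1 x.2.1, D.place_mem_region x.2.2⟩

theorem continuous_placePoint : Continuous D.placePoint := by
  refine continuous_sigma fun k => ?_
  exact (continuous_sigmaMk (σ := fun f => P.region f)).comp
    (((D.continuous_place k).comp continuous_subtype_val).subtype_mk
      fun x => D.place_mem_region x.2)

theorem placePoint_surjective : Function.Surjective D.placePoint := by
  rintro ⟨f, y, hy⟩
  obtain ⟨k, rfl, x, hx, rfl⟩ := D.cover f y hy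
  exact ⟨⟨k, x, hx⟩, rfl⟩

/-- A continuous map from a compact space to a Hausdorff one is closed. Thanks to this, continuity
of the inverse of the induced map needs no inspection of neighbourhoods. -/
theorem isQuotientMap_placePoint : Topology.IsQuotientMap D.placePoint :=
  D.continuous_placePoint.isClosedMap.isQuotientMap D.continuous_placePoint
    D.placePoint_surjective

theorem mk_eq_of_placePoint_eq {x y : Q.Point} (h : D.placePoint x = D.placePoint y) :
    (Quot.mk _ x : Q.Surface) = Quot.mk _ y := by
  obtain ⟨k, x, hx⟩ := x
  obtain ⟨l, y, hy⟩ := y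
  have hf : D.face k = D.face l := congrArg Sigma.fst h
  have hp : D.place k x = D.place l y := congrArg (fun z : P.Point => z.2.1) h
  have hp' := D.lin.injective hp
  by_cases hkl : k = l
  · subst hkl
    obtain rfl := add_right_cancel hp'
    rfl
  · exact Quot.sound (D.overlap k l x y hx hy hkl hf hp')

theorem placePoint_eq {k l : Q.Face} {x y : Plane} {hx : x ∈ Q.region k} {hy : y ∈ Q.region l}
    (hf : D.face k = D.face l) (h : x + D.shift k = y + D.shift l) :
    D.placePoint ⟨k, x, hx⟩ = D.placePoint ⟨l, y, hy⟩ := by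
  have h' : D.place k x = D.place l y := congrArg D.lin h
  unfold placePoint
  simp only
  generalize_proofs h1 h2
  revert h1 h2
  rw [h', hf]
  intros; rfl

theorem place_mem_edge {f : P.Face} {i : Fin (P.size f)} {x : Plane}
    (hx : x ∈ Q.edge (D.edge ⟨f, i⟩).1 (D.edge ⟨f, i⟩).2) :
    D.place (D.edge ⟨f, i⟩).1 x ∈ P.edge f i := by
  obtain ⟨s, t, hs, ht, hst, rfl⟩ := hx
  refine ⟨s, t, hs, ht, hst, ?_⟩
  rw [place_combo _ _ _ _ hst]
  exact congrArg₂ _ (congrArg _ (D.edge_left ⟨f, i⟩).symm)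
    (congrArg _ (D.edge_right ⟨f, i⟩).symm)

theorem exists_place_eq {f : P.Face} {i : Fin (P.size f)} {y : Plane} (hy : y ∈ P.edge f i) :
    ∃ x ∈ Q.edge (D.edge ⟨f, i⟩).1 (D.edge ⟨f, i⟩).2, D.place (D.edge ⟨f, i⟩).1 x = y := by
  obtain ⟨s, t, hs, ht, hst, rfl⟩ := hy
  refine ⟨_, ⟨s, t, hs, ht, hst, rfl⟩, ?_⟩
  rw [place_combo _ _ _ _ hst]
  exact congrArg₂ _ (congrArg _ (D.edge_left ⟨f, i⟩)) (congrArg _ (D.edge_right ⟨f, i⟩))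

theorem placePoint_eq_mk {f : P.Face} {k : Q.Face} {x y : Plane} {hx : x ∈ Q.region k}
    {hy : y ∈ P.region f} (hf : D.face k = f) (h : D.place k x = y) :
    D.placePoint ⟨k, x, hx⟩ = ⟨f, y, hy⟩ := by
  subst hf h; rfl

/-- Two glued sides of `Q` are either pasted together inside one polygon of `P`, and then
corresponding points get the same image, or they become two sides of `P` with the same label, whose
gluing is the image under `lin` of that of `Q`. -/
theorem mk_placePoint_eq_of_glued {x y : Q.Point} (h : Q.Glued x y) :
    (Quot.mk _ (D.placePoint x) : P.Surface) = Quot.mk _ (D.placePoint y) := by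
  obtain ⟨k, x, hx⟩ := x
  obtain ⟨l, y, hy⟩ := y
  obtain ⟨i, j, hne, hl, hxi, hyx⟩ := h
  simp only at hne hl hxi hyx
  rcases D.pasted_or_edge _ _ hne hl with ⟨hf, hp⟩ | ⟨⟨⟨f, m⟩, ht⟩, ⟨⟨g, n⟩, ht'⟩⟩
  · rw [D.placePoint_eq hf]
    simp only at hp
    rw [hyx, eq_sub_iff_add_eq.2 hp]
    abel
  · have hne' : (⟨f, m⟩ : Σ f, Fin (P.size f)) ≠ ⟨g, n⟩ := by
      rintro e
      rw [e, ht'] at ht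
      exact hne ht.symm
    have hl' : P.label f m = P.label g n := by
      apply D.incl_injective
      rw [← D.edge_label ⟨f, m⟩, ← D.edge_label ⟨g, n⟩, ht, ht']
      exact hl
    have e1 := D.edge_face ⟨f, m⟩
    have e2 := D.edge_face ⟨g, n⟩
    have e3 := D.edge_left ⟨f, m⟩
    have e4 := D.edge_right ⟨g, n⟩
    have e5 := D.place_mem_edge (f := f) (i := m) (x := x) (by rw [ht]; exact hxi)
    rw [ht] at e1 e3 e5
    rw [ht'] at e2 e4
    simp only at e1 e2 e3 e4 e5
    have hy' : D.place l y = D.place k x + (P.vertex g (next n) - P.vertex f m) := by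
      rw [← e3, ← e4, hyx]
      simp only [place, map_add, map_sub]
      abel
    have e6 := P.edge_subset_region f m e5
    have e7 : D.place l y ∈ P.region g := e2 ▸ D.place_mem_region hy
    rw [D.placePoint_eq_mk (hy := e6) e1 rfl, D.placePoint_eq_mk (hy := e7) e2 rfl]
    exact P.pt_glue hne' hl' _ _ e5 hy'

theorem mk_eq_of_mk_placePoint_eq {x y : Q.Point}
    (h : (Quot.mk _ (D.placePoint x) : P.Surface) = Quot.mk _ (D.placePoint y)) :
    (Quot.mk _ x : Q.Surface) = Quot.mk _ y := by
  -- The induction runs over the equivalence generated in `P`, so the endpoints are freed from their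
  -- lifts; in the transitive case the middle point is lifted by surjectivity.
  suffices key : ∀ a b, Relation.EqvGen P.Glued a b → ∀ x y, D.placePoint x = a →
      D.placePoint y = b → (Quot.mk _ x : Q.Surface) = Quot.mk _ y from
    key _ _ (Quot.eqvGen_exact h) x y rfl rfl
  clear h x y
  intro a b h
  induction h with
  | rel a b h =>
    intro x y hxa hyb
    obtain ⟨f, a, ha⟩ := a
    obtain ⟨g, b, hb⟩ := b
    obtain ⟨i, j, hne, hl, hai, hba⟩ := h
    simp only at hne hl hai hba
    obtain ⟨x₁, hx₁, ex⟩ := D.exists_place_eq hai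
    obtain ⟨y₁, hy₁, ey⟩ := D.exists_place_eq
      (show b ∈ P.edge g j from hba ▸ P.glue_mem_edge hne hl hai)
    have e1 := D.placePoint_eq_mk (hx := Q.edge_subset_region _ _ hx₁) (hy := ha)
      (D.edge_face ⟨f, i⟩) ex
    have e2 := D.placePoint_eq_mk (hx := Q.edge_subset_region _ _ hy₁) (hy := hb)
      (D.edge_face ⟨g, j⟩) ey
    rw [D.mk_eq_of_placePoint_eq (hxa.trans e1.symm), D.mk_eq_of_placePoint_eq (hyb.trans e2.symm)]
    refine Q.pt_glue (i := (D.edge ⟨f, i⟩).2) (j := (D.edge ⟨g, j⟩).2)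
      (fun h => hne (D.edge_injective h)) ?_ _ _ hx₁ ?_
    · rw [D.edge_label, D.edge_label, hl]
    · have e3 := D.edge_left ⟨f, i⟩
      have e4 := D.edge_right ⟨g, j⟩
      rw [← ex, ← ey] at hba
      simp only at e3 e4
      rw [← e3, ← e4] at hba
      simp only [place, ← map_add, ← map_sub] at hba
      have := D.lin.injective hba
      rw [← sub_eq_zero] at this ⊢
      rw [← this]; abel
  | refl a => exact fun x y hx hy => D.mk_eq_of_placePoint_eq (hx.trans hy.symm)
  | symm a b _ ih => exact fun x y hx hy => (ih y x hy hx).symm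
  | trans a b c _ _ ih ih' =>
    intro x y hx hy
    obtain ⟨z, hz⟩ := D.placePoint_surjective b
    exact (ih x z hx hz).trans (ih' z y hz hy)

/-- The map of surfaces induced by a dissection. -/
def map : Q.Surface → P.Surface :=
  Quot.lift (fun x => Quot.mk _ (D.placePoint x)) fun _ _ h => D.mk_placePoint_eq_of_glued h

theorem map_injective : Function.Injective D.map := by
  rintro ⟨x⟩ ⟨y⟩ h
  exact D.mk_eq_of_mk_placePoint_eq h

theorem isQuotientMap_map : Topology.IsQuotientMap D.map := by
  have h : Topology.IsQuotientMap (D.map ∘ Quot.mk Q.Glued) :=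
    isQuotientMap_quot_mk.comp D.isQuotientMap_placePoint
  exact Topology.IsQuotientMap.of_comp continuous_quot_mk
    (continuous_quot_lift _ (continuous_quot_mk.comp D.continuous_placePoint)) h

/-- The homeomorphism of surfaces induced by a dissection. -/
def homeo : Q.Surface ≃ₜ P.Surface :=
  (isHomeomorph_iff_isQuotientMap_injective.2 ⟨D.isQuotientMap_map, D.map_injective⟩).homeomorph

theorem homeo_pt_eq {f : P.Face} {k : Q.Face} {x y : Plane} (hx : x ∈ Q.region k)
    (hy : y ∈ P.region f) (hf : D.face k = f) (h : D.place k x = y) :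
    D.homeo (Q.pt k x hx) = P.pt f y hy := by
  subst hf h; rfl

/-- The dissection creates no new vertices: the corners of the pieces go to vertices, and every
vertex of `P` begins a side of `P`, which is a side of a piece. -/
theorem homeo_mem_vertices {z : Q.Surface} : D.homeo z ∈ P.vertices ↔ z ∈ Q.vertices := by
  constructor
  · rintro ⟨f, i, h, e⟩
    have h' := Q.vertex_mem_region (D.edge ⟨f, i⟩).1 (D.edge ⟨f, i⟩).2
    refine ⟨_, _, h', D.homeo.injective ?_⟩
    rw [e, D.homeo_pt_eq h' h (D.edge_face ⟨f, i⟩) (D.edge_left ⟨f, i⟩)]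
  · rintro ⟨k, i, h, rfl⟩
    obtain ⟨j, hj⟩ := D.vertex_eq k i
    exact ⟨D.face k, j, P.vertex_mem_region _ j, D.homeo_pt_eq _ _ rfl hj⟩

theorem homeo_mem_side {z : Q.Surface} {l : L} :
    D.homeo z ∈ P.side l ↔ z ∈ Q.side (D.incl l) := by
  obtain ⟨⟨f, i⟩, s', -, hs⟩ := P.paired l
  obtain rfl := (hs ⟨f, i⟩).2 (Or.inl rfl)
  rw [P.mem_side_label, ← D.edge_label ⟨f, i⟩, Q.mem_side_label]
  constructor
  · rintro ⟨y, hy, e⟩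
    obtain ⟨x, hx, h⟩ := D.exists_place_eq hy
    refine ⟨x, hx, D.homeo.injective ?_⟩
    rw [e, D.homeo_pt_eq _ _ (D.edge_face ⟨f, i⟩) h]
  · rintro ⟨x, hx, rfl⟩
    exact ⟨_, D.place_mem_edge hx, D.homeo_pt_eq _ _ (D.edge_face ⟨f, i⟩) rfl⟩

theorem isTrajectory_homeo_comp {v : Plane} {τ : ℝ → Q.Surface} (hτ : Q.IsTrajectory v τ) :
    P.IsTrajectory (D.lin v) (D.homeo ∘ τ) where
  avoids t h := hτ.avoids t (D.homeo_mem_vertices.1 h)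
  forward t := by
    obtain ⟨k, x, ε, hε, h⟩ := hτ.forward t
    refine ⟨D.face k, D.place k x, ε, hε, fun s hs => ?_⟩
    obtain ⟨h1, h2⟩ := h s hs
    have e : D.place k (x + s • v) = D.place k x + s • D.lin v := by
      rw [place_add, map_smul]
    refine ⟨e ▸ D.place_mem_region h1, ?_⟩
    rw [Function.comp_apply, h2]
    exact D.homeo_pt_eq _ _ rfl e
  backward t := by
    obtain ⟨k, x, ε, hε, h⟩ := hτ.backward t
    refine ⟨D.face k, D.place k x, ε, hε, fun s hs => ?_⟩
    obtain ⟨h1, h2⟩ := h s hs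
    have e : D.place k (x - s • v) = D.place k x - s • D.lin v := by
      rw [sub_eq_add_neg, place_add, map_neg, map_smul, ← sub_eq_add_neg]
    refine ⟨e ▸ D.place_mem_region h1, ?_⟩
    rw [Function.comp_apply, h2]
    exact D.homeo_pt_eq _ _ rfl e

/-- A straight stretch in a polygon of `P` is covered by the images of finitely many closed convex
pieces, so an initial part of it lies in just one. This is what trajectories need in order to be
lifted from `P` to `Q`. -/
theorem exists_straight_lift {f : P.Face} {y v : Plane} {ε : ℝ} (hε : 0 < ε)
    (h : ∀ s ∈ Ico 0 ε, y + s • D.lin v ∈ P.region f) :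
    ∃ k x, ∃ δ > 0, δ ≤ ε ∧ ∀ s ∈ Ico (0 : ℝ) δ, D.face k = f ∧
      D.place k (x + s • v) = y + s • D.lin v ∧ x + s • v ∈ Q.region k := by
  have := Q.finite_face
  let C : Q.Face → Set ℝ := fun k =>
    {s | D.face k = f ∧ D.lin.symm y - D.shift k + s • v ∈ Q.region k}
  have hplace : ∀ (k : Q.Face) (s : ℝ),
      D.place k (D.lin.symm y - D.shift k + s • v) = y + s • D.lin v := by
    intro k s
    simp [place]; abel
  have hclosed : ∀ k, IsClosed (C k) := fun k =>
    isClosed_const.inter ((Q.isCompact_region k).isClosed.preimage (by fun_prop))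
  have hconn : ∀ k, (C k).OrdConnected := by
    intro k
    refine Convex.ordConnected ?_
    rintro r ⟨hr, hr'⟩ s ⟨hs, hs'⟩ c d hc hd hcd
    refine ⟨hr, ?_⟩
    have e : D.lin.symm y - D.shift k + (c • r + d • s) • v =
        c • (D.lin.symm y - D.shift k + r • v) + d • (D.lin.symm y - D.shift k + s • v) := by
      obtain rfl : c = 1 - d := by linarith
      simp only [smul_eq_mul]
      module
    exact e ▸ convex_convexHull ℝ _ hr' hs' hc hd hcd
  have hcover : ∀ s ∈ Ioo 0 ε, ∃ k, s ∈ C k := by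
    intro s hs
    obtain ⟨k, hk, x, hx, e⟩ := D.cover f _ (h s ⟨hs.1.le, hs.2⟩)
    refine ⟨k, hk, ?_⟩
    have e' : D.place k x = y + s • D.lin v := e
    rw [← hplace k s] at e'
    rwa [← add_right_cancel (D.lin.injective e')]
  obtain ⟨k, δ, hδ, hδε, hC⟩ := exists_Ico_subset_of_cover hclosed hconn hε hcover
  exact ⟨k, D.lin.symm y - D.shift k, δ, hδ, hδε, fun s hs =>
    ⟨(hC hs).1, hplace k s, (hC hs).2⟩⟩

theorem isTrajectory_of_homeo_comp {v : Plane} {τ : ℝ → Q.Surface}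
    (hτ : P.IsTrajectory (D.lin v) (D.homeo ∘ τ)) : Q.IsTrajectory v τ where
  avoids t h := hτ.avoids t (D.homeo_mem_vertices.2 h)
  forward t := by
    obtain ⟨f, y, ε, hε, h⟩ := hτ.forward t
    obtain ⟨k, x, δ, hδ, hδε, hx⟩ := D.exists_straight_lift hε fun s hs => (h s hs).1
    refine ⟨k, x, δ, hδ, fun s hs => ?_⟩
    obtain ⟨h1, h2, h3⟩ := hx s hs
    obtain ⟨h4, h5⟩ := h s ⟨hs.1, hs.2.trans_le hδε⟩
    exact ⟨h3, D.homeo.injective (h5.trans (D.homeo_pt_eq h3 h4 h1 h2).symm)⟩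
  backward t := by
    obtain ⟨f, y, ε, hε, h⟩ := hτ.backward t
    -- Backward motion is forward motion with the opposite velocity.
    obtain ⟨k, x, δ, hδ, hδε, hx⟩ := D.exists_straight_lift (v := -v) hε fun s hs => by
      simpa [← sub_eq_add_neg] using (h s hs).1
    refine ⟨k, x, δ, hδ, fun s hs => ?_⟩
    obtain ⟨h1, h2, h3⟩ := hx s hs
    obtain ⟨h4, h5⟩ := h s ⟨hs.1, hs.2.trans_le hδε⟩
    simp only [smul_neg, map_neg, ← sub_eq_add_neg] at h2 h3
    exact ⟨h3, D.homeo.injective (h5.trans (D.homeo_pt_eq h3 h4 h1 h2).symm)⟩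

end Dissection

/-! ### The common refinement by eight pieces -/

/-- The labels of the sides of the pieces: those of the first representation, and the primed
letters of the second one along which the polygons of the first one are cut. -/
inductive L0 | A | B | C | D | E | F | G | H | cutB | cutC | cutF | cutG | cutI
  deriving DecidableEq

instance : Fintype L0 :=
  ⟨{.A, .B, .C, .D, .E, .F, .G, .H, .cutB, .cutC, .cutF, .cutG, .cutI},
    fun x => by cases x <;> decide⟩

/-- The numbering provides decidable equality and lets the overlap lemmas treat each unordered pair
of pieces once. -/
def Piece.index : Piece → Fin 8
  | octBottom => 0 | octLower => 1 | octUpper => 2 | octTop => 3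
  | squareLeft => 4 | squareRight => 5 | diamondTop => 6 | diamondBottom => 7

theorem Piece.index_injective : Function.Injective Piece.index := by
  intro k l; cases k <;> cases l <;> simp [Piece.index]

instance : DecidableEq Piece := fun k l =>
  decidable_of_iff _ (Piece.index_injective.eq_iff (a := k) (b := l))

instance : Fintype Piece :=
  ⟨{.octBottom, .octLower, .octUpper, .octTop, .squareLeft, .squareRight, .diamondTop,
    .diamondBottom}, fun x => by cases x <;> decide⟩

def size0 : Piece → ℕ
  | .octBottom | .octTop | .squareLeft | .squareRight | .diamondTop | .diamondBottom => 3
  | .octLower | .octUpper => 4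

/-- The pieces are kept where they lie in the polygons of `R1`, so that the first dissection is by
the identity. -/
def vertex0 : (k : Piece) → Fin (size0 k) → Plane
  | .octBottom => ![![-q, q], ![0, 0], ![1, 0]]
  | .octLower => ![![-q, q], ![1, 0], ![1 + q, q], ![-q, 1 + q]]
  | .octUpper => ![![-q, 1 + q], ![1 + q, q], ![1 + q, 1 + q], ![0, 1 + 2 * q]]
  | .octTop => ![![0, 1 + 2 * q], ![1 + q, 1 + q], ![1, 1 + 2 * q]]
  | .squareLeft => ![![1 + q, q], ![2 + q, q], ![1 + q, 1 + q]]
  | .squareRight => ![![2 + q, q], ![2 + q, 1 + q], ![1 + q, 1 + q]]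
  | .diamondTop => ![![1 + 2 * q, 0], ![1 + q, q], ![1, 0]]
  | .diamondBottom => ![![1 + q, -q], ![1 + 2 * q, 0], ![1, 0]]

def label0 : (k : Piece) → Fin (size0 k) → L0
  | .octBottom => ![.H, .A, .cutG]
  | .octLower => ![.cutG, .B, .cutF, .G]
  | .octUpper => ![.cutF, .C, .cutI, .F]
  | .octTop => ![.cutI, .D, .E]
  | .squareLeft => ![.E, .cutC, .C]
  | .squareRight => ![.G, .A, .cutC]
  | .diamondTop => ![.H, .B, .cutB]
  | .diamondBottom => ![.F, .cutB, .D]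

/-- The pairs of sides of the pieces with equal labels. -/
def gluings : List ((Σ k, Fin (size0 k)) × (Σ k, Fin (size0 k))) :=
  [(⟨.octBottom, (1 : Fin 3)⟩, ⟨.squareRight, (1 : Fin 3)⟩),
   (⟨.octLower, (1 : Fin 4)⟩, ⟨.diamondTop, (1 : Fin 3)⟩),
   (⟨.octUpper, (1 : Fin 4)⟩, ⟨.squareLeft, (2 : Fin 3)⟩),
   (⟨.octTop, (1 : Fin 3)⟩, ⟨.diamondBottom, (2 : Fin 3)⟩),
   (⟨.octTop, (2 : Fin 3)⟩, ⟨.squareLeft, (0 : Fin 3)⟩),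
   (⟨.octUpper, (3 : Fin 4)⟩, ⟨.diamondBottom, (0 : Fin 3)⟩),
   (⟨.octLower, (3 : Fin 4)⟩, ⟨.squareRight, (0 : Fin 3)⟩),
   (⟨.octBottom, (0 : Fin 3)⟩, ⟨.diamondTop, (0 : Fin 3)⟩),
   (⟨.diamondTop, (2 : Fin 3)⟩, ⟨.diamondBottom, (1 : Fin 3)⟩),
   (⟨.squareLeft, (1 : Fin 3)⟩, ⟨.squareRight, (2 : Fin 3)⟩),
   (⟨.octLower, (2 : Fin 4)⟩, ⟨.octUpper, (0 : Fin 4)⟩),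
   (⟨.octBottom, (2 : Fin 3)⟩, ⟨.octLower, (0 : Fin 4)⟩),
   (⟨.octUpper, (2 : Fin 4)⟩, ⟨.octTop, (0 : Fin 3)⟩)]

/-- Reduces properties of pairs of equally labelled sides to thirteen explicit cases and a symmetry.
-/
theorem mem_gluings : ∀ s s' : (Σ k, Fin (size0 k)), s ≠ s' →
    label0 s.1 s.2 = label0 s'.1 s'.2 → (s, s') ∈ gluings ∨ (s', s) ∈ gluings := by
  decide

theorem paired0 : ∀ l : L0, ∃ s s' : (Σ k, Fin (size0 k)), s ≠ s' ∧
    ∀ r : (Σ k, Fin (size0 k)), label0 r.1 r.2 = l ↔ r = s ∨ r = s' := by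
  intro l
  have key : ∃ p ∈ gluings, p.1 ≠ p.2 ∧
    ∀ r : (Σ k, Fin (size0 k)), label0 r.1 r.2 = l ↔ r = p.1 ∨ r = p.2 := by
    revert l; decide
  obtain ⟨p, -, hp⟩ := key
  exact ⟨p.1, p.2, hp⟩

theorem convex0 : ∀ k i j, j ≠ i → j ≠ next i →
    0 < cross (vertex0 k (next i) - vertex0 k i) (vertex0 k j - vertex0 k i) := by
  have := q_pos
  have := q_sq
  intro k
  cases k <;> simp only [size0] <;> intro i j <;> fin_cases i <;> fin_cases j <;> intro h1 h2 <;>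
  first
  | exact absurd rfl h1
  | exact absurd rfl h2
  | (simp [cross, vertex0, next] <;> nlinarith)

theorem opposite0 : ∀ s s' : (Σ k, Fin (size0 k)), s ≠ s' →
    label0 s.1 s.2 = label0 s'.1 s'.2 →
    vertex0 s.1 (next s.2) - vertex0 s.1 s.2 =
      vertex0 s'.1 s'.2 - vertex0 s'.1 (next s'.2) := by
  have key : ∀ p ∈ gluings, vertex0 p.1.1 (next p.1.2) - vertex0 p.1.1 p.1.2 =
      vertex0 p.2.1 p.2.2 - vertex0 p.2.1 (next p.2.2) := by
    intro p hp
    simp only [gluings, List.mem_cons, List.not_mem_nil, or_false] at hp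
    rcases hp with rfl | rfl | rfl | rfl | rfl | rfl | rfl | rfl | rfl | rfl | rfl | rfl | rfl <;>
    (ext k; fin_cases k <;> simp [vertex0, next, size0] <;> ring)
  intro s s' hne hl
  rcases mem_gluings s s' hne hl with hm | hm
  · exact key _ hm
  · rw [← neg_inj, neg_sub, neg_sub]
    exact (key _ hm).symm

/-- The common refinement of the two representations. -/
def pieces : PolygonalSurface L0 where
  Face := Piece
  finite_face := inferInstance
  size := size0
  three_le_size := fun k => by cases k <;> decide
  vertex := vertex0
  label := label0
  convex := convex0
  paired := paired0
  opposite := opposite0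

/-- The barycentric coordinates of `x` are the heights over the opposite sides divided by twice the
area of the triangle. -/
theorem mem_convexHull_triangle {u : Fin 3 → Plane} {x : Plane}
    (hpos : 0 < cross (u 1 - u 0) (u 2 - u 0)) (h0 : 0 ≤ cross (u 1 - u 0) (x - u 0))
    (h1 : 0 ≤ cross (u 2 - u 1) (x - u 1)) (h2 : 0 ≤ cross (u 0 - u 2) (x - u 2)) :
    x ∈ convexHull ℝ (range u) := by
  set d := cross (u 1 - u 0) (u 2 - u 0) with hd
  let w : Fin 3 → ℝ := ![cross (u 2 - u 1) (x - u 1) / d, cross (u 0 - u 2) (x - u 2) / d,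
    cross (u 1 - u 0) (x - u 0) / d]
  have hx : x = ∑ i, w i • u i := by
    ext k
    simp only [w, Fin.sum_univ_three, Pi.add_apply, Pi.smul_apply, smul_eq_mul,
      Matrix.cons_val_zero, Matrix.cons_val_one, Matrix.cons_val]
    rw [div_mul_eq_mul_div, div_mul_eq_mul_div, div_mul_eq_mul_div, ← add_div, ← add_div,
      eq_div_iff hpos.ne', hd]
    fin_cases k <;> simp [cross] <;> ring
  rw [hx]
  refine (convex_convexHull ℝ _).sum_mem ?_ ?_ fun i _ =>
    subset_convexHull _ _ (mem_range_self i)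
  · intro i _
    fin_cases i
    · exact div_nonneg h1 hpos.le
    · exact div_nonneg h2 hpos.le
    · exact div_nonneg h0 hpos.le
  · simp only [w, Fin.sum_univ_three, Matrix.cons_val_zero, Matrix.cons_val_one, Matrix.cons_val]
    rw [← add_div, ← add_div, div_eq_one_iff_eq hpos.ne', hd]
    simp [cross]; ring

/-- The diagonal from `u 0` to `u 2` splits the quadrilateral into two triangles, one of which
contains `x`. -/
theorem mem_convexHull_quadrilateral {u : Fin 4 → Plane} {x : Plane}
    (hpos : 0 < cross (u 1 - u 0) (u 2 - u 0)) (hpos' : 0 < cross (u 2 - u 0) (u 3 - u 0))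
    (h0 : 0 ≤ cross (u 1 - u 0) (x - u 0)) (h1 : 0 ≤ cross (u 2 - u 1) (x - u 1))
    (h2 : 0 ≤ cross (u 3 - u 2) (x - u 2)) (h3 : 0 ≤ cross (u 0 - u 3) (x - u 3)) :
    x ∈ convexHull ℝ (range u) := by
  rcases le_total 0 (cross (u 2 - u 0) (x - u 0)) with hd | hd
  · refine convexHull_mono ?_ (mem_convexHull_triangle (u := u ∘ ![0, 2, 3]) hpos' hd h2 h3)
    exact range_comp_subset_range _ _
  · refine convexHull_mono ?_ (mem_convexHull_triangle (u := u ∘ ![0, 1, 2]) hpos h0 h1 ?_)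
    · exact range_comp_subset_range _ _
    · have : cross (u 0 - u 2) (x - u 2) = -cross (u 2 - u 0) (x - u 0) := by
        simp [cross]; ring
      exact (le_neg.2 (by simpa using hd)).trans_eq this.symm

theorem mem_region_pieces {k : Piece} {x : Plane}
    (hx : ∀ i, 0 ≤ pieces.height k i x) : x ∈ pieces.region k := by
  have tri : ∀ u : Fin 3 → Plane, (∀ i j, j ≠ i → j ≠ next i →
      0 < cross (u (next i) - u i) (u j - u i)) →
      (∀ i, 0 ≤ cross (u (next i) - u i) (x - u i)) → x ∈ convexHull ℝ (range u) :=
    fun u hu h => mem_convexHull_triangle (hu 0 2 (by decide) (by decide)) (h 0) (h 1) (h 2)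
  have quad : ∀ u : Fin 4 → Plane, (∀ i j, j ≠ i → j ≠ next i →
      0 < cross (u (next i) - u i) (u j - u i)) →
      (∀ i, 0 ≤ cross (u (next i) - u i) (x - u i)) → x ∈ convexHull ℝ (range u) := by
    intro u hu h
    refine mem_convexHull_quadrilateral (hu 0 2 (by decide) (by decide)) ?_ (h 0) (h 1) (h 2) (h 3)
    have := hu 2 0 (by decide) (by decide)
    refine this.trans_eq ?_
    simp [cross, next]; ring
  match k with
  | .octBottom => exact tri _ (convex0 .octBottom) hx
  | .octLower => exact quad _ (convex0 .octLower) hx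
  | .octUpper => exact quad _ (convex0 .octUpper) hx
  | .octTop => exact tri _ (convex0 .octTop) hx
  | .squareLeft => exact tri _ (convex0 .squareLeft) hx
  | .squareRight => exact tri _ (convex0 .squareRight) hx
  | .diamondTop => exact tri _ (convex0 .diamondTop) hx
  | .diamondBottom => exact tri _ (convex0 .diamondBottom) hx

namespace PolygonalSurface

variable {L₀ L : Type} {Q : PolygonalSurface L₀} {P : PolygonalSurface L}

/-- Pasted sides have the same line but opposite orientations. Hence a point not on the inner side
of one is on the inner side of the other, which gives covering, and a point on both is on the line,
which controls overlaps. -/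
theorem height_pasted {k l : Q.Face} {i : Fin (Q.size k)} {j : Fin (Q.size l)}
    (hne : (⟨k, i⟩ : Σ k, Fin (Q.size k)) ≠ ⟨l, j⟩) (hl : Q.label k i = Q.label l j)
    {u v : Plane} (hp : Q.vertex k i + u = Q.vertex l (next j) + v) {x y : Plane}
    (h : x + u = y + v) : Q.height k i x = -Q.height l j y := by
  have ho : Q.sideVec k i = -Q.sideVec l j := by
    have := Q.opposite ⟨k, i⟩ ⟨l, j⟩ hne hl
    simp only at this
    rw [sideVec, sideVec, this]; abel
  have hx : x - Q.vertex k i = y - Q.vertex l (next j) := by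
    rw [← add_sub_add_right_eq_sub x _ u, hp, h, add_sub_add_right_eq_sub]
  rw [height, height, ho, hx, cross_neg_left, neg_inj]
  simp only [sideVec, cross, Pi.sub_apply]
  ring

theorem glued_of_pasted {k l : Q.Face} {i : Fin (Q.size k)} {j : Fin (Q.size l)}
    (hkl : k ≠ l) (hl : Q.label k i = Q.label l j) {u v : Plane}
    (hp : Q.vertex k i + u = Q.vertex l (next j) + v) {x y : Plane} (hx : x ∈ Q.region k)
    (hy : y ∈ Q.region l) (h : x + u = y + v) : Q.Glued ⟨k, x, hx⟩ ⟨l, y, hy⟩ := by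
  have hne : (⟨k, i⟩ : Σ k, Fin (Q.size k)) ≠ ⟨l, j⟩ := fun e => hkl (congrArg Sigma.fst e)
  refine Q.glued_mk hne hl hx hy (Q.mem_edge_of_height hx (le_antisymm ?_ (Q.height_nonneg i hx)))
    ?_
  · rw [height_pasted hne hl hp h]
    exact neg_nonpos.2 (Q.height_nonneg j hy)
  · rw [eq_sub_iff_add_eq.2 hp, ← add_sub_cancel_right y v, ← h]; abel

theorem pasted_symm {k l : Q.Face} {i : Fin (Q.size k)} {j : Fin (Q.size l)}
    (hne : (⟨k, i⟩ : Σ k, Fin (Q.size k)) ≠ ⟨l, j⟩) (hl : Q.label k i = Q.label l j)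
    {u v : Plane} (hp : Q.vertex k i + u = Q.vertex l (next j) + v) :
    Q.vertex l j + v = Q.vertex k (next i) + u := by
  have ho := Q.opposite ⟨k, i⟩ ⟨l, j⟩ hne hl
  simp only at ho
  rw [sub_eq_iff_eq_add.1 ho, eq_sub_iff_add_eq.2 hp]; abel

/-- The hypothesis on `lin` says in effect that it preserves orientation, so the inequality for a
side of `P` pulls back to the corresponding side of a piece. -/
theorem height_nonneg_of_image {lin : Plane ≃ₗ[ℝ] Plane}
    (hlin : ∀ u v, 0 ≤ cross (lin u) (lin v) → 0 ≤ cross u v) {k : Q.Face} {j : Fin (Q.size k)}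
    {f : P.Face} {i : Fin (P.size f)} {u : Plane} (hl : lin (Q.vertex k j + u) = P.vertex f i)
    (hr : lin (Q.vertex k (next j) + u) = P.vertex f (next i)) {x y : Plane}
    (hy : y ∈ P.region f) (h : lin (x + u) = y) : 0 ≤ Q.height k j x := by
  refine hlin _ _ ?_
  have := P.height_nonneg i hy
  rw [height, sideVec, ← hl, ← hr, ← h, ← map_sub, ← map_sub] at this
  simpa [sideVec] using this

end PolygonalSurface

open PolygonalSurface

theorem nonneg_of_eq_neg {s t : ℝ} (h : s = -t) (hs : ¬0 ≤ s) : 0 ≤ t := by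
  linarith

theorem pieces_height_nonneg (k : Piece) (i : Fin (size0 k)) {x : Plane}
    (hx : x ∈ pieces.region k) : 0 ≤ pieces.height k i x := height_nonneg (P := pieces) i hx

theorem pieces_height_pasted (k l : Piece) (i : Fin (size0 k)) (j : Fin (size0 l))
    (hkl : k ≠ l) (hl : label0 k i = label0 l j) {u v x y : Plane} (h : x + u = y + v)
    (hp : vertex0 k i + u = vertex0 l (next j) + v) :
    pieces.height k i x = -pieces.height l j y :=
  height_pasted (Q := pieces) (fun e => hkl (congrArg Sigma.fst e)) hl hp h

theorem pieces_glued (k l : Piece) (i : Fin (size0 k)) (j : Fin (size0 l))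
    (hkl : k ≠ l) (hl : label0 k i = label0 l j) {u v x y : Plane} {hx : x ∈ pieces.region k}
    {hy : y ∈ pieces.region l} (h : x + u = y + v)
    (hp : vertex0 k i + u = vertex0 l (next j) + v) : pieces.Glued ⟨k, x, hx⟩ ⟨l, y, hy⟩ :=
  glued_of_pasted (Q := pieces) hkl hl hp hx hy h

/-! ### The dissection of the first representation -/

def incl1 : L1 → L0
  | .A => .A | .B => .B | .C => .C | .D => .D | .E => .E | .F => .F | .G => .G | .H => .H

theorem incl1_injective : Function.Injective incl1 := by
  intro l l'; cases l <;> cases l' <;> simp [incl1]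

def edge1' : (f : Face1) → Fin (size1 f) → Σ k, Fin (size0 k)
  | .oct => ![⟨.octBottom, (1 : Fin 3)⟩, ⟨.octLower, (1 : Fin 4)⟩, ⟨.octUpper, (1 : Fin 4)⟩,
      ⟨.octTop, (1 : Fin 3)⟩, ⟨.octTop, (2 : Fin 3)⟩, ⟨.octUpper, (3 : Fin 4)⟩,
      ⟨.octLower, (3 : Fin 4)⟩, ⟨.octBottom, (0 : Fin 3)⟩]
  | .square => ![⟨.squareLeft, (0 : Fin 3)⟩, ⟨.squareRight, (0 : Fin 3)⟩,
      ⟨.squareRight, (1 : Fin 3)⟩, ⟨.squareLeft, (2 : Fin 3)⟩]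
  | .diamond => ![⟨.diamondBottom, (0 : Fin 3)⟩, ⟨.diamondTop, (0 : Fin 3)⟩,
      ⟨.diamondTop, (1 : Fin 3)⟩, ⟨.diamondBottom, (2 : Fin 3)⟩]

/-- The side of a piece that is a given side of the first representation. -/
def edge1 (s : Σ f, Fin (size1 f)) : Σ k, Fin (size0 k) := edge1' s.1 s.2

theorem edge1_injective : Function.Injective edge1 := by
  have : ∀ s t, edge1 s = edge1 t → s = t := by decide
  exact fun s t => this s t

theorem edge1_face : ∀ s, (edge1 s).1.source = s.1 := by decide

theorem edge1_label : ∀ s, label0 (edge1 s).1 (edge1 s).2 = incl1 (label1 s.1 s.2) := by decide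

theorem edge1_left : ∀ s, vertex0 (edge1 s).1 (edge1 s).2 = vertex1 s.1 s.2 := by
  rintro ⟨f, i⟩
  revert i
  cases f <;> simp only [size1] <;> intro i <;> fin_cases i <;> rfl

theorem edge1_right : ∀ s, vertex0 (edge1 s).1 (next (edge1 s).2) = vertex1 s.1 (next s.2) := by
  rintro ⟨f, i⟩
  revert i
  cases f <;> simp only [size1] <;> intro i <;> fin_cases i <;> rfl

def corner1 : (k : Piece) → Fin (size0 k) → Fin (size1 k.source)
  | .octBottom => (![7, 0, 1] : Fin 3 → Fin 8)
  | .octLower => (![7, 1, 2, 6] : Fin 4 → Fin 8)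
  | .octUpper => (![6, 2, 3, 5] : Fin 4 → Fin 8)
  | .octTop => (![5, 3, 4] : Fin 3 → Fin 8)
  | .squareLeft => (![0, 1, 3] : Fin 3 → Fin 4)
  | .squareRight => (![1, 2, 3] : Fin 3 → Fin 4)
  | .diamondTop => (![1, 2, 3] : Fin 3 → Fin 4)
  | .diamondBottom => (![0, 1, 3] : Fin 3 → Fin 4)

theorem vertex0_eq : ∀ k i, vertex0 k i = vertex1 k.source (corner1 k i) := by
  intro k
  cases k <;> simp only [size0] <;> intro i <;> fin_cases i <;> rfl

theorem pasted_or_edge1 : ∀ s s' : (Σ k, Fin (size0 k)), s ≠ s' →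
    label0 s.1 s.2 = label0 s'.1 s'.2 →
    (s.1.source = s'.1.source ∧
      vertex0 s.1 s.2 + 0 = vertex0 s'.1 (next s'.2) + 0) ∨
    (s ∈ range edge1 ∧ s' ∈ range edge1) := by
  have key : ∀ p ∈ gluings, (p.1.1.source = p.2.1.source ∧
      vertex0 p.1.1 p.1.2 + 0 = vertex0 p.2.1 (next p.2.2) + 0) ∨
      ((∃ t, edge1 t = p.1) ∧ ∃ t, edge1 t = p.2) := by
    intro p hp
    simp only [gluings, List.mem_cons, List.not_mem_nil, or_false] at hp
    rcases hp with rfl | rfl | rfl | rfl | rfl | rfl | rfl | rfl | rfl | rfl | rfl | rfl | rfl <;>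
    first
    | exact Or.inl ⟨rfl, rfl⟩
    | exact Or.inr ⟨by decide, by decide⟩
  intro s s' hne hl
  rcases mem_gluings s s' hne hl with hm | hm
  · exact key _ hm
  · rcases key _ hm with ⟨h1, h2⟩ | h1
    · exact Or.inl ⟨h1.symm, pasted_symm (Q := pieces) hne.symm hl.symm h2⟩
    · exact Or.inr h1.symm

theorem overlap1 (k l : Piece) (x y : Plane) (hx : x ∈ pieces.region k) (hy : y ∈ pieces.region l)
    (hkl : k ≠ l) (hf : k.source = l.source) (h : x + 0 = y + 0) :
    pieces.Glued ⟨k, x, hx⟩ ⟨l, y, hy⟩ := by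
  have hq := q_pos
  have hq2 := q_sq
  have key : ∀ (k l : Piece) (x y : Plane) (hx : x ∈ pieces.region k) (hy : y ∈ pieces.region l),
      k.index < l.index → k.source = l.source → x + 0 = y + 0 →
      pieces.Glued ⟨k, x, hx⟩ ⟨l, y, hy⟩ := by
    clear hkl hf h hx hy x y k l
    intro k l
    cases k <;> cases l <;> intro x y hx hy hlt hf h <;>
    first
    | exact absurd hlt (by decide)
    | exact absurd hf (by decide)
    | skip
    · exact pieces_glued .octBottom .octLower (2 : Fin 3) (0 : Fin 4) (by decide) rfl h rfl
    -- Pieces of the octagon that are not adjacent are disjoint, since they are separated by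
    -- distinct parallel diagonals.
    · obtain rfl : x = y := by simpa using h
      have h1 : 0 ≤ cross (![-q, q] - ![1, 0]) (x - ![1, 0]) :=
        pieces_height_nonneg .octBottom (2 : Fin 3) hx
      have h2 : 0 ≤ cross (![1 + q, q] - ![-q, 1 + q]) (x - ![-q, 1 + q]) :=
        pieces_height_nonneg .octUpper (0 : Fin 4) hy
      simp only [cross, Pi.sub_apply, Matrix.cons_val_zero, Matrix.cons_val_one] at h1 h2
      -- The directions of the two diagonals are proportional because `q * q = 1 / 2`: multiplying
      -- `(-1 - q, q)` by `q` gives `-1 / 2` times `(1 + 2 * q, -1)`, so the linear parts cancel.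
      have h3 := mul_nonneg hq.le h1
      have e0 : q * q * x 0 = 1 / 2 * x 0 := by rw [hq2]
      have e1 : q * q * x 1 = 1 / 2 * x 1 := by rw [hq2]
      nlinarith
    · obtain rfl : x = y := by simpa using h
      have h1 : 0 ≤ cross (![-q, q] - ![1, 0]) (x - ![1, 0]) :=
        pieces_height_nonneg .octBottom (2 : Fin 3) hx
      have h2 : 0 ≤ cross (![1 + q, 1 + q] - ![0, 1 + 2 * q]) (x - ![0, 1 + 2 * q]) :=
        pieces_height_nonneg .octTop (0 : Fin 3) hy
      simp only [cross, Pi.sub_apply, Matrix.cons_val_zero, Matrix.cons_val_one] at h1 h2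
      nlinarith
    · exact pieces_glued .octLower .octUpper (2 : Fin 4) (0 : Fin 4) (by decide) rfl h rfl
    · obtain rfl : x = y := by simpa using h
      have h1 : 0 ≤ cross (![-q, 1 + q] - ![1 + q, q]) (x - ![1 + q, q]) :=
        pieces_height_nonneg .octLower (2 : Fin 4) hx
      have h2 : 0 ≤ cross (![1 + q, 1 + q] - ![0, 1 + 2 * q]) (x - ![0, 1 + 2 * q]) :=
        pieces_height_nonneg .octTop (0 : Fin 3) hy
      simp only [cross, Pi.sub_apply, Matrix.cons_val_zero, Matrix.cons_val_one] at h1 h2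
      have h3 := mul_nonneg hq.le h2
      have e0 : q * q * x 0 = 1 / 2 * x 0 := by rw [hq2]
      have e1 : q * q * x 1 = 1 / 2 * x 1 := by rw [hq2]
      nlinarith
    · exact pieces_glued .octUpper .octTop (2 : Fin 4) (0 : Fin 3) (by decide) rfl h rfl
    · exact pieces_glued .squareLeft .squareRight (1 : Fin 3) (2 : Fin 3) (by decide) rfl h rfl
    · exact pieces_glued .diamondTop .diamondBottom (2 : Fin 3) (1 : Fin 3) (by decide) rfl h rfl
  rcases lt_or_gt_of_ne (Piece.index_injective.ne hkl) with hlt | hlt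
  · exact key k l x y hx hy hlt hf h
  · exact (key l k y x hy hx hlt hf.symm h.symm).symm

theorem cover1 : ∀ f, ∀ y ∈ R1.region f, ∃ k : Piece, k.source = f ∧
    ∃ x ∈ pieces.region k, x + 0 = y := by
  intro f y hy
  simp only [add_zero, exists_eq_right]
  have H : ∀ s : (Σ f, Fin (size1 f)), s.1 = f → 0 ≤ pieces.height (edge1 s).1 (edge1 s).2 y := by
    rintro ⟨f, i⟩ rfl
    exact height_nonneg_of_image (Q := pieces) (P := R1) (lin := LinearEquiv.refl ℝ Plane)
      (fun _ _ h => h) (u := 0)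
      ((add_zero _).trans (edge1_left ⟨f, i⟩)) ((add_zero _).trans (edge1_right ⟨f, i⟩)) hy
      (add_zero y)
  cases f
  · have e1 := pieces_height_pasted .octBottom .octLower (2 : Fin 3) (0 : Fin 4) (by decide) rfl
      (rfl : y + 0 = y + 0) rfl
    have e2 := pieces_height_pasted .octLower .octUpper (2 : Fin 4) (0 : Fin 4) (by decide) rfl
      (rfl : y + 0 = y + 0) rfl
    have e3 := pieces_height_pasted .octUpper .octTop (2 : Fin 4) (0 : Fin 3) (by decide) rfl
      (rfl : y + 0 = y + 0) rfl
    have hA := H ⟨.oct, (0 : Fin 8)⟩ rfl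
    have hB := H ⟨.oct, (1 : Fin 8)⟩ rfl
    have hC := H ⟨.oct, (2 : Fin 8)⟩ rfl
    have hD := H ⟨.oct, (3 : Fin 8)⟩ rfl
    have hE := H ⟨.oct, (4 : Fin 8)⟩ rfl
    have hF := H ⟨.oct, (5 : Fin 8)⟩ rfl
    have hG := H ⟨.oct, (6 : Fin 8)⟩ rfl
    have hH := H ⟨.oct, (7 : Fin 8)⟩ rfl
    -- The point goes to the first piece, from the bottom, whose upper cut it has not passed; each
    -- failed test supplies the inequality at the lower cut of the next piece.
    by_cases h1 : 0 ≤ pieces.height .octBottom (2 : Fin 3) y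
    · refine ⟨.octBottom, rfl, mem_region_pieces (k := .octBottom) ?_⟩
      exact Fin.forall_fin_succ.2 ⟨hH, Fin.forall_fin_two.2 ⟨hA, h1⟩⟩
    by_cases h2 : 0 ≤ pieces.height .octLower (2 : Fin 4) y
    · refine ⟨.octLower, rfl, mem_region_pieces (k := .octLower) ?_⟩
      exact Fin.forall_fin_succ.2 ⟨nonneg_of_eq_neg e1 h1, Fin.forall_fin_succ.2 ⟨hB,
        Fin.forall_fin_two.2 ⟨h2, hG⟩⟩⟩
    by_cases h3 : 0 ≤ pieces.height .octUpper (2 : Fin 4) y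
    · refine ⟨.octUpper, rfl, mem_region_pieces (k := .octUpper) ?_⟩
      exact Fin.forall_fin_succ.2 ⟨nonneg_of_eq_neg e2 h2, Fin.forall_fin_succ.2 ⟨hC,
        Fin.forall_fin_two.2 ⟨h3, hF⟩⟩⟩
    · refine ⟨.octTop, rfl, mem_region_pieces (k := .octTop) ?_⟩
      exact Fin.forall_fin_succ.2 ⟨nonneg_of_eq_neg e3 h3, Fin.forall_fin_two.2 ⟨hD, hE⟩⟩
  · have e1 := pieces_height_pasted .squareLeft .squareRight (1 : Fin 3) (2 : Fin 3) (by decide) rfl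
      (rfl : y + 0 = y + 0) rfl
    have hE := H ⟨.square, (0 : Fin 4)⟩ rfl
    have hG := H ⟨.square, (1 : Fin 4)⟩ rfl
    have hA := H ⟨.square, (2 : Fin 4)⟩ rfl
    have hC := H ⟨.square, (3 : Fin 4)⟩ rfl
    by_cases h1 : 0 ≤ pieces.height .squareLeft (1 : Fin 3) y
    · refine ⟨.squareLeft, rfl, mem_region_pieces (k := .squareLeft) ?_⟩
      exact Fin.forall_fin_succ.2 ⟨hE, Fin.forall_fin_two.2 ⟨h1, hC⟩⟩
    · refine ⟨.squareRight, rfl, mem_region_pieces (k := .squareRight) ?_⟩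
      exact Fin.forall_fin_succ.2 ⟨hG, Fin.forall_fin_two.2 ⟨hA, nonneg_of_eq_neg e1 h1⟩⟩
  · have e1 := pieces_height_pasted .diamondTop .diamondBottom (2 : Fin 3) (1 : Fin 3) (by decide) rfl
      (rfl : y + 0 = y + 0) rfl
    have hF := H ⟨.diamond, (0 : Fin 4)⟩ rfl
    have hH := H ⟨.diamond, (1 : Fin 4)⟩ rfl
    have hB := H ⟨.diamond, (2 : Fin 4)⟩ rfl
    have hD := H ⟨.diamond, (3 : Fin 4)⟩ rfl
    by_cases h1 : 0 ≤ pieces.height .diamondTop (2 : Fin 3) y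
    · refine ⟨.diamondTop, rfl, mem_region_pieces (k := .diamondTop) ?_⟩
      exact Fin.forall_fin_succ.2 ⟨hH, Fin.forall_fin_two.2 ⟨hB, h1⟩⟩
    · refine ⟨.diamondBottom, rfl, mem_region_pieces (k := .diamondBottom) ?_⟩
      exact Fin.forall_fin_succ.2 ⟨hF, Fin.forall_fin_two.2 ⟨nonneg_of_eq_neg e1 h1, hD⟩⟩

/-- The dissection of the first representation into the pieces. -/
def dissection1 : Dissection pieces R1 where
  lin := LinearEquiv.refl ℝ Plane
  face := Piece.source
  shift := fun _ => 0
  incl := incl1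
  edge := edge1
  vertex_eq k i := ⟨corner1 k i, (add_zero _).trans (vertex0_eq k i)⟩
  cover := cover1
  overlap := overlap1
  edge_injective := edge1_injective
  edge_face := edge1_face
  edge_left s := (add_zero _).trans (edge1_left s)
  edge_right s := (add_zero _).trans (edge1_right s)
  edge_label := edge1_label
  incl_injective := incl1_injective
  pasted_or_edge := pasted_or_edge1

/-! ### The dissection of the second representation -/

theorem b_eq : b = q * a := rfl

theorem sigma_mulVec (x : Plane) :
    σ.mulVec x = ![b * (x 0 + x 1) + a / 2 * x 1, h * a * x 1] := by
  have h3 : √3 * √3 = 3 := Real.mul_self_sqrt (by norm_num)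
  have e : σ = σ₃ * !![b, 0; 0, h * a] * σ₁ := rfl
  rw [e]
  have h3' : √3 / 3 * (h * a) = a / 2 := by
    unfold h; linear_combination a / 6 * h3
  ext i
  fin_cases i
  · simp [σ₁, σ₃, Matrix.mulVec, Matrix.mul_apply, Fin.sum_univ_two, dotProduct]
    linear_combination x 1 * h3'
  · simp [σ₁, σ₃, Matrix.mulVec, Matrix.mul_apply, Fin.sum_univ_two, dotProduct]

/-- The factor is the determinant of `σ`. It is positive, so `σ` preserves the inequalities that
define the polygons. -/
theorem cross_sigma (u v : Plane) :
    cross (σ.mulVec u) (σ.mulVec v) = b * (h * a) * cross u v := by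
  rw [sigma_mulVec, sigma_mulVec]
  simp [cross]; ring

theorem sigma_injective : Function.Injective (Matrix.mulVecLin σ) := by
  rw [← LinearMap.ker_eq_bot, LinearMap.ker_eq_bot']
  intro x hx
  rw [Matrix.mulVecLin_apply, sigma_mulVec] at hx
  have h1 : h * a * x 1 = 0 := congrFun hx 1
  have h0 : b * (x 0 + x 1) + a / 2 * x 1 = 0 := congrFun hx 0
  have hx1 : x 1 = 0 := (mul_eq_zero.1 h1).resolve_left (mul_pos h_pos a_pos).ne'
  have hx0 : x 0 = 0 := by
    rw [hx1, add_zero, mul_zero, add_zero] at h0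
    exact (mul_eq_zero.1 h0).resolve_left b_pos.ne'
  ext i
  fin_cases i
  · exact hx0
  · exact hx1

/-- The linear automorphism `σ` of the plane. -/
def sigmaLinearEquiv : Plane ≃ₗ[ℝ] Plane := LinearEquiv.ofInjectiveEndo _ sigma_injective

theorem sigmaLinearEquiv_apply (x : Plane) : sigmaLinearEquiv x = σ.mulVec x := rfl

theorem cross_nonneg_of_sigma (u v : Plane)
    (huv : 0 ≤ cross (sigmaLinearEquiv u) (sigmaLinearEquiv v)) :
    0 ≤ cross u v := by
  rw [sigmaLinearEquiv_apply, sigmaLinearEquiv_apply, cross_sigma] at huv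
  exact nonneg_of_mul_nonneg_right huv (mul_pos b_pos (mul_pos h_pos a_pos))

/-- Only `A`, `D`, `E`, `H` are sides of both representations; the other five sides of the second
one are cuts of the first one. -/
def incl2 : L2 → L0
  | .A => .A | .B => .cutB | .C => .cutC | .D => .D | .E => .E | .F => .cutF | .G => .cutG
  | .H => .H | .I => .cutI

theorem incl2_injective : Function.Injective incl2 := by
  intro l l'; cases l <;> cases l' <;> simp [incl2]

def edge2' : (f : Face2) → Fin (size2 f) → Σ k, Fin (size0 k)
  | .tri₁ => ![⟨.octBottom, (1 : Fin 3)⟩, ⟨.octBottom, (2 : Fin 3)⟩, ⟨.octBottom, (0 : Fin 3)⟩]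
  | .hex₁ => ![⟨.octLower, (0 : Fin 4)⟩, ⟨.diamondTop, (2 : Fin 3)⟩, ⟨.diamondTop, (0 : Fin 3)⟩,
      ⟨.octLower, (2 : Fin 4)⟩, ⟨.squareRight, (1 : Fin 3)⟩, ⟨.squareRight, (2 : Fin 3)⟩]
  | .hex₂ => ![⟨.octUpper, (0 : Fin 4)⟩, ⟨.squareLeft, (0 : Fin 3)⟩, ⟨.squareLeft, (1 : Fin 3)⟩,
      ⟨.octUpper, (2 : Fin 4)⟩, ⟨.diamondBottom, (1 : Fin 3)⟩, ⟨.diamondBottom, (2 : Fin 3)⟩]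
  | .tri₂ => ![⟨.octTop, (1 : Fin 3)⟩, ⟨.octTop, (2 : Fin 3)⟩, ⟨.octTop, (0 : Fin 3)⟩]

/-- The side of a piece that is a given side of the second representation. -/
def edge2 (s : Σ f, Fin (size2 f)) : Σ k, Fin (size0 k) := edge2' s.1 s.2

theorem edge2_injective : Function.Injective edge2 := by
  have : ∀ s t, edge2 s = edge2 t → s = t := by decide
  exact fun s t => this s t

theorem edge2_face : ∀ s, (edge2 s).1.target = s.1 := by decide

theorem edge2_label : ∀ s, label0 (edge2 s).1 (edge2 s).2 = incl2 (label2 s.1 s.2) := by decide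

def corner2 : (k : Piece) → Fin (size0 k) → Fin (size2 k.target)
  | .octBottom => (![2, 0, 1] : Fin 3 → Fin 3)
  | .octLower => (![0, 1, 3, 4] : Fin 4 → Fin 6)
  | .octUpper => (![0, 1, 3, 4] : Fin 4 → Fin 6)
  | .octTop => (![2, 0, 1] : Fin 3 → Fin 3)
  | .squareLeft => (![1, 2, 3] : Fin 3 → Fin 6)
  | .squareRight => (![0, 4, 5] : Fin 3 → Fin 6)
  | .diamondTop => (![2, 3, 1] : Fin 3 → Fin 6)
  | .diamondBottom => (![0, 4, 5] : Fin 3 → Fin 6)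

/-- The geometric heart of the cut and paste: the corners of the moved pieces land on the vertices
of the triangles and hexagons. It comes down to `b = q * a` and `q * q = 1 / 2`. -/
theorem sigma_vertex0 : ∀ k i,
    σ.mulVec (vertex0 k i + k.shift) = vertex2 k.target (corner2 k i) := by
  have h1 : q * (q * a) = a / 2 := by rw [← mul_assoc, q_sq]; ring
  have h2 : q * (q * (h * a)) = h * a / 2 := by rw [← mul_assoc, q_sq]; ring
  have h3 : q * (q * (q * a)) = q * a / 2 := by rw [h1]; ring
  intro k
  cases k <;> simp only [size0] <;> intro i <;> fin_cases i <;>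
  (rw [sigma_mulVec, b_eq]; ext j
   fin_cases j <;> simp [vertex0, vertex2, corner2, Piece.shift, Piece.target, b_eq] <;>
   linarith)

theorem edge2_left : ∀ s,
    σ.mulVec (vertex0 (edge2 s).1 (edge2 s).2 + (edge2 s).1.shift) = vertex2 s.1 s.2 := by
  rintro ⟨f, i⟩
  revert i
  cases f <;> simp only [size2] <;> intro i <;> fin_cases i <;> exact sigma_vertex0 _ _

theorem edge2_right : ∀ s,
    σ.mulVec (vertex0 (edge2 s).1 (next (edge2 s).2) + (edge2 s).1.shift) =
      vertex2 s.1 (next s.2) := by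
  rintro ⟨f, i⟩
  revert i
  cases f <;> simp only [size2] <;> intro i <;> fin_cases i <;> exact sigma_vertex0 _ _

theorem pasted_or_edge2 : ∀ s s' : (Σ k, Fin (size0 k)), s ≠ s' →
    label0 s.1 s.2 = label0 s'.1 s'.2 →
    (s.1.target = s'.1.target ∧
      vertex0 s.1 s.2 + s.1.shift = vertex0 s'.1 (next s'.2) + s'.1.shift) ∨
    (s ∈ range edge2 ∧ s' ∈ range edge2) := by
  have key : ∀ p ∈ gluings, (p.1.1.target = p.2.1.target ∧
      vertex0 p.1.1 p.1.2 + p.1.1.shift = vertex0 p.2.1 (next p.2.2) + p.2.1.shift) ∨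
      ((∃ t, edge2 t = p.1) ∧ ∃ t, edge2 t = p.2) := by
    intro p hp
    simp only [gluings, List.mem_cons, List.not_mem_nil, or_false] at hp
    rcases hp with rfl | rfl | rfl | rfl | rfl | rfl | rfl | rfl | rfl | rfl | rfl | rfl | rfl <;>
    first
    | exact Or.inr ⟨by decide, by decide⟩
    | (refine Or.inl ⟨rfl, ?_⟩
       ext i
       fin_cases i <;> simp [vertex0, next, size0, Piece.shift] <;> ring)
  intro s s' hne hl
  rcases mem_gluings s s' hne hl with hm | hm
  · exact key _ hm
  · rcases key _ hm with ⟨h1, h2⟩ | h1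
    · exact Or.inl ⟨h1.symm, pasted_symm (Q := pieces) hne.symm hl.symm h2⟩
    · exact Or.inr h1.symm

theorem pasted_B : vertex0 .octLower (1 : Fin 4) + Piece.shift .octLower =
    vertex0 .diamondTop (next (1 : Fin 3)) + Piece.shift .diamondTop := rfl

theorem pasted_G : vertex0 .octLower (3 : Fin 4) + Piece.shift .octLower =
    vertex0 .squareRight (next (0 : Fin 3)) + Piece.shift .squareRight := by
  change ![-q, 1 + q] + 0 = ![2 + q, 1 + q] + ![-2 - 2 * q, 0]
  ext i
  fin_cases i <;> simp; ring

theorem pasted_C : vertex0 .octUpper (1 : Fin 4) + Piece.shift .octUpper =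
    vertex0 .squareLeft (next (2 : Fin 3)) + Piece.shift .squareLeft := rfl

theorem pasted_F : vertex0 .octUpper (3 : Fin 4) + Piece.shift .octUpper =
    vertex0 .diamondBottom (next (0 : Fin 3)) + Piece.shift .diamondBottom := by
  change ![0, 1 + 2 * q] + 0 = ![1 + 2 * q, 0] + ![-1 - 2 * q, 1 + 2 * q]
  ext i
  fin_cases i <;> simp

theorem overlap2 (k l : Piece) (x y : Plane) (hx : x ∈ pieces.region k) (hy : y ∈ pieces.region l)
    (hkl : k ≠ l) (hf : k.target = l.target) (hxy : x + k.shift = y + l.shift) :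
    pieces.Glued ⟨k, x, hx⟩ ⟨l, y, hy⟩ := by
  have hq := q_pos
  have key : ∀ (k l : Piece) (x y : Plane) (hx : x ∈ pieces.region k) (hy : y ∈ pieces.region l),
      k.index < l.index → k.target = l.target → x + k.shift = y + l.shift →
      pieces.Glued ⟨k, x, hx⟩ ⟨l, y, hy⟩ := by
    clear hkl hf hxy hx hy x y k l
    intro k l
    cases k <;> cases l <;> intro x y hx hy hlt hf hxy <;>
    first
    | exact absurd hlt (by decide)
    | exact absurd hf (by decide)
    | skip
    · exact pieces_glued .octLower .squareRight (3 : Fin 4) (0 : Fin 3) (by decide) rfl hxy pasted_G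
    · exact pieces_glued .octLower .diamondTop (1 : Fin 4) (1 : Fin 3) (by decide) rfl hxy pasted_B
    · exact pieces_glued .octUpper .squareLeft (1 : Fin 4) (2 : Fin 3) (by decide) rfl hxy pasted_C
    · exact pieces_glued .octUpper .diamondBottom (3 : Fin 4) (0 : Fin 3) (by decide) rfl hxy
        pasted_F
    -- The two triangles attached to the second hexagon lie on different sides of a vertical strip:
    -- first coordinates at least `1 + q` for one, at most `0` for the other after its shift.
    · have h1 : 0 ≤ cross (![1 + q, q] - ![1 + q, 1 + q]) (x - ![1 + q, 1 + q]) :=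
        pieces_height_nonneg .squareLeft (2 : Fin 3) hx
      have h2 : 0 ≤ cross (![1 + 2 * q, 0] - ![1 + q, -q]) (y - ![1 + q, -q]) :=
        pieces_height_nonneg .diamondBottom (0 : Fin 3) hy
      have h3 : 0 ≤ cross (![1, 0] - ![1 + 2 * q, 0]) (y - ![1 + 2 * q, 0]) :=
        pieces_height_nonneg .diamondBottom (1 : Fin 3) hy
      have h4 : x 0 + 0 = y 0 + (-1 - 2 * q) := congrFun hxy 0
      simp only [cross, Pi.sub_apply, Matrix.cons_val_zero, Matrix.cons_val_one] at h1 h2 h3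
      have h5 : 0 ≤ q * (y 1 + 1 + 2 * q - y 0) := by linarith
      have h6 : 0 ≤ q * (-y 1) := by linarith
      have h7 := nonneg_of_mul_nonneg_right h5 hq
      have h8 := nonneg_of_mul_nonneg_right h6 hq
      linarith
    -- Likewise in the first hexagon: at most `-q` after the shift against at least `1`.
    · have h1 : 0 ≤ cross (![2 + q, 1 + q] - ![2 + q, q]) (x - ![2 + q, q]) :=
        pieces_height_nonneg .squareRight (0 : Fin 3) hx
      have h2 : 0 ≤ cross (![1, 0] - ![1 + q, q]) (y - ![1 + q, q]) :=
        pieces_height_nonneg .diamondTop (1 : Fin 3) hy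
      have h3 : 0 ≤ cross (![1 + 2 * q, 0] - ![1, 0]) (y - ![1, 0]) :=
        pieces_height_nonneg .diamondTop (2 : Fin 3) hy
      have h4 : x 0 + (-2 - 2 * q) = y 0 + 0 := congrFun hxy 0
      simp only [cross, Pi.sub_apply, Matrix.cons_val_zero, Matrix.cons_val_one] at h1 h2 h3
      have h5 : 0 ≤ q * (y 0 - 1 - y 1) := by linarith
      have h6 : 0 ≤ q * y 1 := by linarith
      have h7 := nonneg_of_mul_nonneg_right h5 hq
      have h8 := nonneg_of_mul_nonneg_right h6 hq
      linarith
  rcases lt_or_gt_of_ne (Piece.index_injective.ne hkl) with hlt | hlt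
  · exact key k l x y hx hy hlt hf hxy
  · exact (key l k y x hy hx hlt hf.symm hxy.symm).symm

theorem cover2 : ∀ f, ∀ y ∈ R2.region f, ∃ k : Piece, k.target = f ∧
    ∃ x ∈ pieces.region k, sigmaLinearEquiv (x + k.shift) = y := by
  intro f y hy
  obtain ⟨z, rfl⟩ := sigmaLinearEquiv.surjective y
  have H : ∀ s : (Σ f, Fin (size2 f)), s.1 = f →
      0 ≤ pieces.height (edge2 s).1 (edge2 s).2 (z - (edge2 s).1.shift) := by
    rintro ⟨f, i⟩ rfl
    exact height_nonneg_of_image (Q := pieces) (P := R2) (lin := sigmaLinearEquiv)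
      cross_nonneg_of_sigma (u := (edge2 ⟨f, i⟩).1.shift) (edge2_left ⟨f, i⟩) (edge2_right ⟨f, i⟩)
      hy (congrArg sigmaLinearEquiv (sub_add_cancel _ _))
  suffices key : ∃ k : Piece, k.target = f ∧ ∀ i, 0 ≤ pieces.height k i (z - k.shift) by
    obtain ⟨k, hk, hz⟩ := key
    exact ⟨k, hk, _, mem_region_pieces hz, congrArg sigmaLinearEquiv (sub_add_cancel _ _)⟩
  have hz : ∀ k l : Piece, z - k.shift + k.shift = z - l.shift + l.shift := by simp
  cases f
  · exact ⟨.octBottom, rfl, Fin.forall_fin_succ.2 ⟨H ⟨.tri₁, (2 : Fin 3)⟩ rfl,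
      Fin.forall_fin_two.2 ⟨H ⟨.tri₁, (0 : Fin 3)⟩ rfl, H ⟨.tri₁, (1 : Fin 3)⟩ rfl⟩⟩⟩
  · have e1 := pieces_height_pasted .octLower .diamondTop (1 : Fin 4) (1 : Fin 3) (by decide) rfl
      (hz _ _) pasted_B
    have e2 := pieces_height_pasted .octLower .squareRight (3 : Fin 4) (0 : Fin 3) (by decide) rfl
      (hz _ _) pasted_G
    have hG := H ⟨.hex₁, (0 : Fin 6)⟩ rfl
    have hB := H ⟨.hex₁, (1 : Fin 6)⟩ rfl
    have hH := H ⟨.hex₁, (2 : Fin 6)⟩ rfl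
    have hF := H ⟨.hex₁, (3 : Fin 6)⟩ rfl
    have hA := H ⟨.hex₁, (4 : Fin 6)⟩ rfl
    have hC := H ⟨.hex₁, (5 : Fin 6)⟩ rfl
    -- The hexagon is a trapezoid with a triangle on two of its sides. Each triangle has a single
    -- side that is not one of the hexagon, so one test decides membership.
    by_cases h1 : 0 ≤ pieces.height .octLower (1 : Fin 4) (z - Piece.shift .octLower)
    · by_cases h2 : 0 ≤ pieces.height .octLower (3 : Fin 4) (z - Piece.shift .octLower)
      · exact ⟨.octLower, rfl, Fin.forall_fin_succ.2 ⟨hG, Fin.forall_fin_succ.2 ⟨h1,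
          Fin.forall_fin_two.2 ⟨hF, h2⟩⟩⟩⟩
      · exact ⟨.squareRight, rfl, Fin.forall_fin_succ.2 ⟨nonneg_of_eq_neg e2 h2,
          Fin.forall_fin_two.2 ⟨hA, hC⟩⟩⟩
    · exact ⟨.diamondTop, rfl, Fin.forall_fin_succ.2 ⟨hH,
        Fin.forall_fin_two.2 ⟨nonneg_of_eq_neg e1 h1, hB⟩⟩⟩
  · have e1 := pieces_height_pasted .octUpper .squareLeft (1 : Fin 4) (2 : Fin 3) (by decide) rfl
      (hz _ _) pasted_C
    have e2 := pieces_height_pasted .octUpper .diamondBottom (3 : Fin 4) (0 : Fin 3) (by decide) rfl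
      (hz _ _) pasted_F
    have hF := H ⟨.hex₂, (0 : Fin 6)⟩ rfl
    have hE := H ⟨.hex₂, (1 : Fin 6)⟩ rfl
    have hC := H ⟨.hex₂, (2 : Fin 6)⟩ rfl
    have hI := H ⟨.hex₂, (3 : Fin 6)⟩ rfl
    have hB := H ⟨.hex₂, (4 : Fin 6)⟩ rfl
    have hD := H ⟨.hex₂, (5 : Fin 6)⟩ rfl
    by_cases h1 : 0 ≤ pieces.height .octUpper (1 : Fin 4) (z - Piece.shift .octUpper)
    · by_cases h2 : 0 ≤ pieces.height .octUpper (3 : Fin 4) (z - Piece.shift .octUpper)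
      · exact ⟨.octUpper, rfl, Fin.forall_fin_succ.2 ⟨hF, Fin.forall_fin_succ.2 ⟨h1,
          Fin.forall_fin_two.2 ⟨hI, h2⟩⟩⟩⟩
      · exact ⟨.diamondBottom, rfl, Fin.forall_fin_succ.2 ⟨nonneg_of_eq_neg e2 h2,
          Fin.forall_fin_two.2 ⟨hB, hD⟩⟩⟩
    · exact ⟨.squareLeft, rfl, Fin.forall_fin_succ.2 ⟨hE,
        Fin.forall_fin_two.2 ⟨hC, nonneg_of_eq_neg e1 h1⟩⟩⟩
  · exact ⟨.octTop, rfl, Fin.forall_fin_succ.2 ⟨H ⟨.tri₂, (2 : Fin 3)⟩ rfl,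
      Fin.forall_fin_two.2 ⟨H ⟨.tri₂, (0 : Fin 3)⟩ rfl, H ⟨.tri₂, (1 : Fin 3)⟩ rfl⟩⟩⟩

/-- The dissection of the second representation into the images of the pieces. -/
def dissection2 : Dissection pieces R2 where
  lin := sigmaLinearEquiv
  face := Piece.target
  shift := Piece.shift
  incl := incl2
  edge := edge2
  vertex_eq k i := ⟨corner2 k i, sigma_vertex0 k i⟩
  cover := cover2
  overlap := overlap2
  edge_injective := edge2_injective
  edge_face := edge2_face
  edge_left := edge2_left
  edge_right := edge2_right
  edge_label := edge2_label
  incl_injective := incl2_injective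
  pasted_or_edge := pasted_or_edge2

/-! ### The transition diagram of the pieces -/

/-- The possible pairs of consecutive letters of the cutting sequences of the trajectories with
directions in `[7π/8, π]` with respect to the sides of the pieces. -/
def trans0 : L0 → L0 → Bool
  | .A, .H | .cutG, .H | .B, .cutG | .B, .G | .cutF, .G | .C, .cutF | .C, .F | .cutI, .F
  | .D, .cutI | .D, .E | .E, .C | .cutC, .C | .G, .A | .G, .cutC | .H, .B | .cutB, .B
  | .F, .D | .F, .cutB => true
  | _, _ => false

/-- For a nonzero velocity the two inequalities confine it to the sector between the directions
`(-(1 + q), q)`, that is `7π/8`, and `π`. There the signs of the determinants with the side vectors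
tell which sides can be entered and which can be left. Only two pairs outside the list survive this
test: crossing a trapezoid from one of its parallel sides to the other. -/
theorem trans0_of_crossing {v : Plane} (hv : 0 ≤ v 1) (hv' : (1 + q) * v 1 + q * v 0 ≤ 0) :
    ∀ (k : Piece) (i j : Fin (size0 k)) (x : Plane) (d : ℝ), 0 < d →
      x ∈ segment ℝ (vertex0 k i) (vertex0 k (next i)) →
      x + d • v ∈ segment ℝ (vertex0 k j) (vertex0 k (next j)) →
      0 < cross (vertex0 k (next i) - vertex0 k i) v →
      cross (vertex0 k (next j) - vertex0 k j) v < 0 → (∀ m, x ≠ vertex0 k m) →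
      trans0 (label0 k i) (label0 k j) = true := by
  have hq := q_pos
  have c1 := mul_nonneg hq.le hv
  -- This is `hv'` multiplied by `q`, the form suited to the long diagonal.
  have c2 : v 0 / 2 + q * v 1 + v 1 / 2 ≤ 0 := by
    have h1 := mul_nonneg hq.le (neg_nonneg.2 hv')
    have h2 : q * q * v 0 = 1 / 2 * v 0 := by rw [q_sq]
    have h3 : q * q * v 1 = 1 / 2 * v 1 := by rw [q_sq]
    linarith
  intro k
  cases k <;> simp only [size0] <;> intro i j <;> fin_cases i <;> fin_cases j <;>
  intro x d hd hx hy h1 h2 hne <;>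
  first
  | rfl
  | (exfalso; simp [cross, vertex0, next] at h1; linarith)
  | (exfalso; simp [cross, vertex0, next] at h2; linarith)
  | skip
  -- The second coordinate does not decrease along the motion, but it is at least `q` on the side of
  -- entry and at most `q` on that of exit, so the motion would start at a vertex.
  · obtain ⟨s, t, hs, ht, hst, rfl⟩ : x ∈ segment ℝ ![1 + q, q] ![-q, 1 + q] := hx
    obtain ⟨s', t', hs', ht', hst', e⟩ : _ ∈ segment ℝ ![-q, q] ![1, 0] := hy
    have e1 := congrFun e 1
    simp at e1
    obtain rfl : s' = 1 - t' := by linarith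
    obtain rfl : s = 1 - t := by linarith
    have h3 := mul_nonneg hd.le hv
    have h4 := mul_nonneg ht' hq.le
    obtain rfl : t = 0 := by linarith
    exact (hne (2 : Fin 4) (by simp [vertex0])).elim
  -- The same argument, with the level `1 + q`.
  · obtain ⟨s, t, hs, ht, hst, rfl⟩ : x ∈ segment ℝ ![1 + q, 1 + q] ![0, 1 + 2 * q] := hx
    obtain ⟨s', t', hs', ht', hst', e⟩ : _ ∈ segment ℝ ![-q, 1 + q] ![1 + q, q] := hy
    have e1 := congrFun e 1
    simp at e1
    obtain rfl : s' = 1 - t' := by linarith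
    obtain rfl : s = 1 - t := by linarith
    have h3 := mul_nonneg hd.le hv
    have h4 : t * q ≤ 0 := by linarith
    obtain rfl : t = 0 := le_antisymm (nonpos_of_mul_nonpos_left h4 hq) ht
    exact (hne (2 : Fin 4) (by simp [vertex0])).elim

/-- With `φ = π - θ ≤ π/8` one has `φ ≤ π/4 - φ`, hence `sin φ ≤ sin (π/4 - φ) = q cos φ - q sin φ`;
the value of the tangent of `π/8` is not needed. -/
theorem direction_sector {θ r : ℝ} (hθ : θ ∈ Icc (7 * Real.pi / 8) Real.pi) (hr : 0 < r) :
    r • direction θ ≠ 0 ∧ 0 ≤ (r • direction θ) 1 ∧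
      (1 + q) * (r • direction θ) 1 + q * (r • direction θ) 0 ≤ 0 := by
  have hpi := Real.pi_pos
  have hs : 0 ≤ Real.sin θ := Real.sin_nonneg_of_nonneg_of_le_pi (by linarith [hθ.1]) hθ.2
  have hc : Real.cos θ < 0 := Real.cos_neg_of_pi_div_two_lt_of_lt (by linarith [hθ.1])
    (by linarith [hθ.2])
  have key : Real.sin θ ≤ Real.sin (θ - 3 * Real.pi / 4) := by
    rw [← Real.sin_pi_sub]
    exact Real.sin_le_sin_of_le_of_le_pi_div_two (by linarith [hθ.2]) (by linarith [hθ.2])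
      (by linarith [hθ.1])
  rw [show θ - 3 * Real.pi / 4 = Real.pi / 4 - (Real.pi - θ) by ring, Real.sin_sub,
    Real.sin_pi_sub, Real.cos_pi_sub, Real.sin_pi_div_four, Real.cos_pi_div_four] at key
  change _ ≤ q * -Real.cos θ - q * Real.sin θ at key
  have e0 : (r • direction θ) 0 = r * Real.cos θ := rfl
  have e1 : (r • direction θ) 1 = r * Real.sin θ := rfl
  refine ⟨fun h0 => ?_, e1 ▸ mul_nonneg hr.le hs, ?_⟩
  · rw [h0] at e0
    exact (mul_neg_of_pos_of_neg hr hc).ne e0.symm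
  · rw [e0, e1]
    have := mul_nonneg hr.le (sub_nonneg.2 key)
    linarith

/-! ### Subwords of bi-infinite words -/

/-- `w` is the subword of the letters of `w₀` in the image of `ι`. -/
def IsSubword {L L₀ : Type} (ι : L → L₀) (w₀ : ℤ → L₀) (w : ℤ → L) : Prop :=
  ∃ s : ℤ → ℤ, StrictMono s ∧ range s = {n | w₀ n ∈ range ι} ∧ ∀ n, w₀ (s n) = ι (w n)

theorem IsSubword.shift {L L₀ : Type} {ι : L → L₀} {w₀ : ℤ → L₀} {w w' : ℤ → L} {c : ℤ}
    (hw : IsSubword ι w₀ w) (h' : ∀ n, w' n = w (n + c)) : IsSubword ι w₀ w' := by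
  obtain ⟨s, hs, hr, hl⟩ := hw
  refine ⟨fun n => s (n + c), fun m n hmn => hs (by omega), ?_, fun n => by rw [hl, h']⟩
  rw [← hr]
  exact (Equiv.addRight c).surjective.range_comp s

/-- The sides of `P` are the sides of `Q` with labels in the image of `incl`, so the hits in `P` are
some of the hits in `Q`. Enumerating them in order of time amounts to enumerating their indices in
`w₀` in increasing order. -/
theorem Dissection.isCuttingSequence_homeo_comp {L₀ L : Type} {Q : PolygonalSurface L₀}
    {P : PolygonalSurface L} (D : Dissection Q P) {v : Plane} {τ : ℝ → Q.Surface}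
    (hτ : Q.IsTrajectory v τ) {t₀ : ℤ → ℝ} {w₀ : ℤ → L₀} (ht₀ : StrictMono t₀)
    (hr₀ : range t₀ = Q.hits τ) (hw₀ : ∀ n, τ (t₀ n) ∈ Q.side (w₀ n)) {w : ℤ → L} :
    P.IsCuttingSequence (D.homeo ∘ τ) w ↔ IsSubword D.incl w₀ w := by
  have hside : ∀ r l, (D.homeo ∘ τ) r ∈ P.side l ↔ τ r ∈ Q.side (D.incl l) := fun r l =>
    D.homeo_mem_side
  have hlabel : ∀ n l, τ (t₀ n) ∈ Q.side l ↔ w₀ n = l := fun n l =>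
    ⟨fun hl => Q.label_eq_of_mem_side (hw₀ n) hl (hτ.avoids _), fun hl => hl ▸ hw₀ n⟩
  unfold IsCuttingSequence IsSubword
  simp only [hside]
  constructor
  · rintro ⟨t, ht, hr, hw⟩
    have hex : ∀ n, ∃ m, t₀ m = t n := fun n => by
      have : t n ∈ Q.hits τ := ⟨_, hw n⟩
      rwa [← hr₀] at this
    choose s hs using hex
    refine ⟨s, fun m n hmn => ?_, ?_, fun n => ?_⟩
    · rw [← ht₀.lt_iff_lt, hs, hs]; exact ht hmn
    · ext n
      constructor
      · rintro ⟨m, rfl⟩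
        exact ⟨w m, ((hlabel _ _).1 (hs m ▸ hw m)).symm⟩
      · rintro ⟨l, hl⟩
        have : t₀ n ∈ range t := by
          rw [hr]; exact ⟨l, (hlabel _ _).2 hl.symm⟩
        obtain ⟨m, hm⟩ := this
        exact ⟨m, ht₀.injective ((hs m).trans hm)⟩
    · exact (hlabel _ _).1 (hs n ▸ hw n)
  · rintro ⟨s, hs, hr, hw⟩
    refine ⟨t₀ ∘ s, ht₀.comp hs, ?_, fun n => (hlabel _ _).2 (hw n)⟩
    ext r
    constructor
    · rintro ⟨n, rfl⟩
      exact ⟨w n, (hlabel _ _).2 (hw n)⟩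
    · rintro ⟨l, hl⟩
      have : r ∈ range t₀ := by rw [hr₀]; exact ⟨_, hl⟩
      obtain ⟨n, rfl⟩ := this
      have : n ∈ range s := by
        rw [hr]; exact ⟨l, ((hlabel _ _).1 hl).symm⟩
      obtain ⟨m, rfl⟩ := this
      exact ⟨m, rfl⟩

/-- A strictly increasing sequence of integers passes every integer. -/
theorem exists_lt_le_of_strictMono {s : ℤ → ℤ} (hs : StrictMono s) (m : ℤ) :
    ∃ k, s (k - 1) < m ∧ m ≤ s k := by
  -- Growth by at least one at each step makes `s` unbounded in both directions.
  have hmono : Monotone fun k => s k - k := monotone_int_of_le_succ fun k => by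
    have := hs (lt_add_one k)
    omega
  have hne : ∃ k, m ≤ s k := by
    refine ⟨max 0 (m - s 0), ?_⟩
    have := hmono (le_max_left 0 (m - s 0))
    simp only at this
    omega
  have hbdd : ∃ b, ∀ k, m ≤ s k → b ≤ k := by
    refine ⟨min 0 (m - s 0), fun k hk => ?_⟩
    by_contra! hlt
    have := hmono (hlt.le.trans (min_le_left _ _))
    simp only at this
    omega
  obtain ⟨k, hk, hleast⟩ := Int.exists_least_of_bdd hbdd hne
  refine ⟨k, ?_, hk⟩
  by_contra! hlt
  have := hleast _ hlt
  omega

theorem eq_of_lt_le {s : ℤ → ℤ} (hs : StrictMono s) {m k l : ℤ} (hk : s (k - 1) < m)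
    (hk' : m ≤ s k) (hl : s (l - 1) < m) (hl' : m ≤ s l) : k = l := by
  have h1 := hs.lt_iff_lt.1 (hk.trans_le hl')
  have h2 := hs.lt_iff_lt.1 (hl.trans_le hk')
  omega

/-! ### The derived sequence as a subword -/

/-- The letter of the second representation that a letter of the pieces stands for, if any. -/
def letters2 : L0 → List L2
  | .A => [.A] | .D => [.D] | .E => [.E] | .H => [.H]
  | .B | .C | .F | .G => []
  | .cutB => [.B] | .cutC => [.C] | .cutF => [.F] | .cutG => [.G] | .cutI => [.I]

instance : Fintype L1 := ⟨{.A, .B, .C, .D, .E, .F, .G, .H}, fun x => by cases x <;> decide⟩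

instance : Fintype L2 := ⟨{.A, .B, .C, .D, .E, .F, .G, .H, .I}, fun x => by cases x <;> decide⟩

theorem letters2_incl2 : ∀ e, letters2 (incl2 e) = [e] := by decide

theorem letters2_eq_nil_or : ∀ x, letters2 x = [] ∨ ∃ e, incl2 e = x := by decide

theorem keep_eq : ∀ c, keep c = letters2 (incl1 c) := by decide

theorem arrow_of_trans0 : ∀ c d, trans0 (incl1 c) (incl1 d) = true → arrow c d = some [] := by
  decide

/-- Two cuts are never crossed in succession, so at most one lies between consecutive letters of the
first representation. -/
theorem exists_incl1_of_trans0 : ∀ x y, trans0 x y = true → (∃ c, incl1 c = x) ∨ ∃ c, incl1 c = y :=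
  by decide

/-- This is where the letters on the arrows come from: each is the cut crossed between the two
sides. -/
theorem arrow_of_trans0_trans0 : ∀ y, (∀ c, incl1 c ≠ y) → ∀ c d, trans0 (incl1 c) y = true →
    trans0 y (incl1 d) = true → arrow c d = some (letters2 y) := by decide

/-- The word `u` reads `l` from the index `k` on. -/
def Reads (u : ℤ → L2) (k : ℤ) (l : List L2) : Prop := ∀ i (hi : i < l.length), u (k + i) = l[i]

theorem Reads.append {u : ℤ → L2} {k : ℤ} {l l' : List L2} (hl : Reads u k l)
    (hl' : Reads u (k + l.length) l') : Reads u k (l ++ l') := by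
  intro i hi
  by_cases h1 : i < l.length
  · rw [List.getElem_append_left h1, hl i h1]
  · rw [List.getElem_append_right (by omega), ← hl' (i - l.length) (by simp at hi; omega)]
    congr 1
    push_cast [Nat.le_of_not_lt h1]
    ring

/-- The stretch of `w₀` from one letter of `w` up to the next consists of that letter and at most
one cut. Its letters of the second representation are exactly the block that derivation puts there,
so `u` is the concatenation of the blocks. -/
theorem isDerived_of_isSubword {w₀ : ℤ → L0} (htrans : ∀ n, trans0 (w₀ n) (w₀ (n + 1)) = true)
    {w : ℤ → L1} {u : ℤ → L2} (hw : IsSubword incl1 w₀ w) (hu : IsSubword incl2 w₀ u) :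
    IsDerived w u := by
  obtain ⟨s₁, hs₁, hr₁, hw⟩ := hw
  obtain ⟨s₂, hs₂, hr₂, hu⟩ := hu
  have hnext : ∀ n m, s₁ n < m → (∀ m', s₁ n < m' → m' < m → ∀ c, incl1 c ≠ w₀ m') →
      (∃ c, incl1 c = w₀ m) → s₁ (n + 1) = m := by
    rintro n m hnm hlt hm
    have hm' : m ∈ range s₁ := by rw [hr₁]; exact hm
    obtain ⟨j, rfl⟩ := hm'
    have h1 : n < j := hs₁.lt_iff_lt.1 hnm
    have h2 : s₁ (n + 1) ≤ s₁ j := hs₁.monotone h1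
    refine le_antisymm h2 (not_lt.1 fun h3 => ?_)
    exact hlt _ (hs₁ (lt_add_one n)) h3 _ (hw (n + 1)).symm
  have hgap : ∀ n, ∃ l, arrow (w n) (w (n + 1)) = some l ∧
      ((l = [] ∧ s₁ (n + 1) = s₁ n + 1) ∨
        (l = letters2 (w₀ (s₁ n + 1)) ∧ s₁ (n + 1) = s₁ n + 1 + 1)) := by
    intro n
    have h1 := htrans (s₁ n)
    by_cases hc : ∃ c, incl1 c = w₀ (s₁ n + 1)
    · have h2 : s₁ (n + 1) = s₁ n + 1 :=
        hnext n _ (lt_add_one _) (fun m' h h' => by omega) hc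
      refine ⟨[], arrow_of_trans0 _ _ ?_, Or.inl ⟨rfl, h2⟩⟩
      rwa [← hw, ← hw, h2]
    · have h3 := htrans (s₁ n + 1)
      have h2 : s₁ (n + 1) = s₁ n + 1 + 1 := by
        refine hnext n _ (by omega) (fun m' h h' => ?_)
          ((exists_incl1_of_trans0 _ _ h3).resolve_left hc)
        obtain rfl : m' = s₁ n + 1 := by omega
        exact fun c hc' => hc ⟨c, hc'⟩
      refine ⟨_, arrow_of_trans0_trans0 (w₀ (s₁ n + 1)) (fun c hc' => hc ⟨c, hc'⟩) _ _ ?_ ?_,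
        Or.inr ⟨rfl, h2⟩⟩
      · rwa [← hw]
      · rwa [← hw, h2]
  -- `g m` is the index in `u` of the first of its letters at or after position `m` of `w₀`; the
  -- blocks will start at `g (s₁ n)`.
  choose g hg hg' using exists_lt_le_of_strictMono hs₂
  have hstep : ∀ m, g (m + 1) = g m + (letters2 (w₀ m)).length ∧
      Reads u (g m) (letters2 (w₀ m)) := by
    intro m
    by_cases hm : ∃ e, incl2 e = w₀ m
    · have hm' : m ∈ range s₂ := by rw [hr₂]; exact hm
      obtain ⟨j, rfl⟩ := hm'
      have h1 : g (s₂ j) = j := eq_of_lt_le hs₂ (hg _) (hg' _) (hs₂ (by omega)) le_rfl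
      have h2 : g (s₂ j + 1) = j + 1 := by
        refine eq_of_lt_le hs₂ (hg _) (hg' _) ?_ ?_
        · rw [add_sub_cancel_right]; exact lt_add_one _
        · exact hs₂ (lt_add_one j)
      rw [hu, letters2_incl2, h1, h2]
      refine ⟨rfl, fun i hi => ?_⟩
      obtain rfl : i = 0 := by simpa using hi
      simp
    · have h1 := (letters2_eq_nil_or (w₀ m)).resolve_right hm
      rw [h1]
      refine ⟨?_, fun i hi => absurd hi (Nat.not_lt_zero i)⟩
      have h2 : m ≠ s₂ (g m) := by
        intro h
        exact hm ⟨u (g m), by rw [← hu, ← h]⟩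
      have h3 := hg' m
      have h4 := hg m
      simpa using eq_of_lt_le hs₂ (hg (m + 1)) (hg' (m + 1)) (l := g m) (by omega) (by omega)
  have hblock : ∀ n, g (s₁ (n + 1)) = g (s₁ n) + (block w n).length ∧
      Reads u (g (s₁ n)) (block w n) := by
    intro n
    obtain ⟨l, hl, ⟨rfl, hn⟩ | ⟨rfl, hn⟩⟩ := hgap n
    · rw [block, hl, keep_eq, ← hw, hn, Option.getD_some, List.append_nil]
      exact hstep _
    · obtain ⟨h1, h2⟩ := hstep (s₁ n)
      obtain ⟨h3, h4⟩ := hstep (s₁ n + 1)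
      rw [block, hl, keep_eq, ← hw, hn, Option.getD_some]
      refine ⟨?_, h2.append (h1 ▸ h4)⟩
      rw [h3, h1, List.length_append]; push_cast; ring
  refine ⟨fun n => ?_, fun n => g (s₁ n), fun n => (hblock n).1, fun m => ?_,
    fun n i => (hblock n).2 i i.2⟩
  · obtain ⟨l, hl, -⟩ := hgap n
    rw [hl]; rfl
  -- The `+ 1` makes `s₁ (k - 1)` the last position of a letter of `w` that is not after `s₂ m`, so
  -- the letter `m` of `u` lies in block `k - 1`.
  · obtain ⟨k, hk, hk'⟩ := exists_lt_le_of_strictMono hs₁ (s₂ m + 1)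
    refine ⟨k - 1, ?_, ?_⟩
    · change g (s₁ (k - 1)) ≤ m
      have := hs₂.lt_iff_lt.1 ((hg (s₁ (k - 1))).trans_le (Int.lt_add_one_iff.1 hk))
      omega
    · have := hs₂.lt_iff_lt.1 ((Int.lt_iff_add_one_le.2 hk').trans_le (hg' (s₁ k)))
      rwa [sub_add_cancel]

/-- The derived sequence is determined up to a shift. -/
theorem IsDerived.exists_shift {w : ℤ → L1} {u u' : ℤ → L2} (hu : IsDerived w u)
    (hu' : IsDerived w u') : ∃ c, ∀ m, u m = u' (m + c) := by
  obtain ⟨-, p, hp, hcov, hread⟩ := hu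
  obtain ⟨-, p', hp', -, hread'⟩ := hu'
  -- The lengths of the blocks depend on `w` alone, so the starting indices differ by a constant.
  have hc : ∀ n, p' n - p n = p' 0 - p 0 := by
    intro n
    induction n using Int.induction_on with
    | zero => rfl
    | succ n ih => rw [hp, hp']; omega
    | pred n ih =>
      have h1 := hp (-n - 1)
      have h2 := hp' (-n - 1)
      rw [sub_add_cancel] at h1 h2
      omega
  refine ⟨p' 0 - p 0, fun m => ?_⟩
  obtain ⟨n, hn, hn'⟩ := hcov m
  have hlen : (m - p n).toNat < (block w n).length := by
    have := hp n
    omega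
  have h1 := hread n ⟨_, hlen⟩
  have h2 := hread' n ⟨_, hlen⟩
  simp only at h1 h2
  rw [← h2] at h1
  convert h1 using 2
  · omega
  · have := hc n
    omega

/-! ### The affine map -/

theorem range_corner1 : ∀ k, range (corner1 k) = k.corners := by
  intro k
  cases k <;> simp [corner1, Piece.corners, size0, Piece.source, size1] <;> ext m <;>
  simp only [mem_insert_iff, mem_singleton_iff] <;> tauto

theorem Piece.region_eq (k : Piece) : k.region = pieces.region k := by
  have : vertex0 k = vertex1 k.source ∘ corner1 k := funext (vertex0_eq k)
  change convexHull ℝ _ = convexHull ℝ (range (vertex0 k))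
  rw [this, range_comp, range_corner1]

/-- The prescription on each piece is a prescription on the whole refined surface, which the first
dissection identifies with `R1`; existence and uniqueness both follow. -/
theorem isInducedMap_iff {Ψ : R1.Surface ≃ₜ R2.Surface} :
    IsInducedMap Ψ ↔ ∀ z, Ψ (dissection1.homeo z) = dissection2.homeo z := by
  have h1 : ∀ (k : Piece) (x : Plane) (hx : x ∈ pieces.region k) (hx' : x ∈ R1.region k.source),
      dissection1.homeo (pieces.pt k x hx) = R1.pt k.source x hx' := fun k x hx hx' =>
    dissection1.homeo_pt_eq hx hx' rfl (add_zero x)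
  have h1' : ∀ (k : Piece) (x : Plane), x ∈ pieces.region k → x ∈ R1.region k.source := by
    intro k x hx
    have := dissection1.place_mem_region hx
    rwa [show dissection1.place k x = x from add_zero x] at this
  constructor
  · rintro hΨ ⟨⟨k, x, hx⟩⟩
    obtain ⟨hx1, hx2, e⟩ := hΨ k x (k.region_eq.symm ▸ hx)
    exact (congrArg Ψ (h1 k x hx hx1)).trans e
  · intro hΨ k x hx
    rw [k.region_eq] at hx
    refine ⟨h1' k x hx, dissection2.place_mem_region hx, ?_⟩
    rw [← h1 k x hx, hΨ]
    rfl

theorem existsUnique_isInducedMap : ∃! Ψ : R1.Surface ≃ₜ R2.Surface, IsInducedMap Ψ := by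
  refine ⟨dissection1.homeo.symm.trans dissection2.homeo, isInducedMap_iff.2 fun z => by simp,
    fun Ψ hΨ => ?_⟩
  ext z
  rw [← dissection1.homeo.apply_symm_apply z, isInducedMap_iff.1 hΨ]
  simp

end BouwMoller

end

/-! ### Comparison of the two cutting sequences -/

theorem mainTheorem1 :
    (∃! Ψ : BouwMoller.R1.Surface ≃ₜ BouwMoller.R2.Surface, BouwMoller.IsInducedMap Ψ) ∧
    ∀ Ψ : BouwMoller.R1.Surface ≃ₜ BouwMoller.R2.Surface, BouwMoller.IsInducedMap Ψ →
      ∀ θ ∈ Set.Icc (7 * Real.pi / 8) Real.pi, ∀ r : ℝ, 0 < r → ∀ τ : ℝ → BouwMoller.R1.Surface,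
        BouwMoller.R1.IsTrajectory (r • BouwMoller.direction θ) τ →
          BouwMoller.R2.IsTrajectory (BouwMoller.σ.mulVec (r • BouwMoller.direction θ)) (Ψ ∘ τ) ∧
          (∃ w, BouwMoller.R1.IsCuttingSequence τ w) ∧
          ∀ w, BouwMoller.R1.IsCuttingSequence τ w →
            (∃ u, BouwMoller.IsDerived w u) ∧
            ∀ u, BouwMoller.IsDerived w u ↔ BouwMoller.R2.IsCuttingSequence (Ψ ∘ τ) u := by
  open BouwMoller BouwMoller.PolygonalSurface in
  refine ⟨existsUnique_isInducedMap, fun Ψ hΨ θ hθ r hr τ hτ => ?_⟩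
  obtain ⟨hv, hv1, hv2⟩ := direction_sector hθ hr
  set v := r • direction θ
  -- From here on both trajectories are images of the same trajectory in the refined surface.
  obtain ⟨τ₀, rfl⟩ : ∃ τ₀, τ = dissection1.homeo ∘ τ₀ :=
    ⟨dissection1.homeo.symm ∘ τ, by ext; simp⟩
  have hτ₀ : pieces.IsTrajectory v τ₀ := dissection1.isTrajectory_of_homeo_comp hτ
  have hΨτ : Ψ ∘ dissection1.homeo ∘ τ₀ = dissection2.homeo ∘ τ₀ :=
    funext fun t => isInducedMap_iff.1 hΨ (τ₀ t)
  rw [hΨτ]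
  have hτ₂ : R2.IsTrajectory (σ.mulVec v) (dissection2.homeo ∘ τ₀) :=
    dissection2.isTrajectory_homeo_comp hτ₀
  have hv₂ : σ.mulVec v ≠ 0 := (map_ne_zero_iff sigmaLinearEquiv sigmaLinearEquiv.injective).2 hv
  obtain ⟨w₀, t₀, ht₀, hr₀, hw₀⟩ := hτ₀.exists_isCuttingSequence hv
  have htrans : ∀ n, trans0 (w₀ n) (w₀ (n + 1)) = true := by
    intro n
    obtain ⟨k, i, j, x, hx, d, hd, hy, hi, hj, h1, h2, hne⟩ :=
      hτ₀.exists_crossing ht₀ hr₀ hw₀ n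
    rw [← hi, ← hj]
    exact trans0_of_crossing hv1 hv2 k i j x d hd hx hy h1 h2 hne
  have iff₁ := fun w => dissection1.isCuttingSequence_homeo_comp hτ₀ ht₀ hr₀ hw₀ (w := w)
  have iff₂ := fun w => dissection2.isCuttingSequence_homeo_comp hτ₀ ht₀ hr₀ hw₀ (w := w)
  refine ⟨hτ₂, hτ.exists_isCuttingSequence hv, fun w hw => ?_⟩
  have hsub := (iff₁ w).1 hw
  obtain ⟨u₀, hu₀⟩ := hτ₂.exists_isCuttingSequence hv₂
  have hd₀ := isDerived_of_isSubword htrans hsub ((iff₂ u₀).1 hu₀)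
  refine ⟨⟨u₀, hd₀⟩, fun u => ⟨fun hu => ?_, fun hu => ?_⟩⟩
  -- Any derived sequence is a shift of the cutting sequence `u₀`, and being a subword of `w₀` is
  -- invariant under shifts.
  · obtain ⟨c, hc⟩ := hu.exists_shift hd₀
    exact (iff₂ u).2 (((iff₂ u₀).1 hu₀).shift hc)
  · exact isDerived_of_isSubword htrans hsub ((iff₂ u).1 hu)
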